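/- For $n\ge 1$, let $\lambda_3(n)$ denote the maximum length of a Davenport--Schinzel sequence of order $3$ on $n$ distinct symbols, that is, of a finite sequence in which exactly $n$ distinct symbols occur, no two adjacent terms are equal, and there are no two distinct symbols $a \ne b$ for which $a\,b\,a\,b\,a$ is a (not necessarily contiguous) subsequence. Define the Ackermann hierarchy by $A_1(n) = 2n$ and $A_k(n) = A_{k-1}^{(n)}(1)$ for $k \ge 2$ and $n \ge 0$, where $f^{(n)}$ denotes the $n$-fold composition of $f$. Let $A(k) = A_k(3)$ for $k\ge 1$, and let the inverse Ackermann function be $\alpha(n) = \min\{k \ge 1 \mid A(k) \ge n\}$. **Theorem.** $\lambda_3(n) \ge 2n\,\alpha(n) - O(n)$; that is, there is an absolute constant $C$ such that for every integer $n \ge 1$, $$\lambda_3(n) \ \ge\ 2n\,\alpha(n) - C n .$$ -/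

import Mathlib

/-! ### Davenport--Schinzel sequences -/

/-- The alternation `a b a b …` of length `k`, starting with `a`. -/
def alternation (a b : ℕ) : ℕ → List ℕ
  | 0 => []
  | k + 1 => a :: alternation b a k

/-- `S` is a Davenport--Schinzel sequence of order `s`: no two adjacent symbols are equal, and for
distinct symbols `a ≠ b` the alternation `a b a b …` of length `s + 2` is not a (not necessarily
contiguous) subsequence of `S`. -/
def IsDavenportSchinzel (s : ℕ) (S : List ℕ) : Prop :=
  S.IsChain (· ≠ ·) ∧ ∀ a b : ℕ, a ≠ b → ¬ (alternation a b (s + 2)).Sublist S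

/-- The lengths of the Davenport--Schinzel sequences of order `s` on `n` distinct symbols. -/
def dsLengths (s n : ℕ) : Set ℕ :=
  {ℓ | ∃ S : List ℕ, IsDavenportSchinzel s S ∧ S.toFinset.card = n ∧ S.length = ℓ}

/-- `λ_s(n)`: the maximum length of a Davenport--Schinzel sequence of order `s` on `n` distinct
symbols (the maximum exists for `s ≥ 1`, see `isGreatest_dsLambda`). -/
noncomputable def dsLambda (s n : ℕ) : ℕ := sSup (dsLengths s n)

/-- The pairs formed by the entries number `2i` and `2i + 1` of a list. -/
def consecutivePairs : List ℕ → List (ℕ × ℕ)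
  | x :: y :: l => (x, y) :: consecutivePairs l
  | _ => []

theorem length_le_consecutivePairs :
    ∀ l : List ℕ, l.length ≤ 2 * (consecutivePairs l).length + 1
  | [] => by simp
  | [_] => by simp [consecutivePairs]
  | _ :: _ :: l => by
    have := length_le_consecutivePairs l
    simp only [consecutivePairs, List.length_cons]
    omega

theorem mem_consecutivePairs :
    ∀ (l : List ℕ) (p : ℕ × ℕ), l.IsChain (· ≠ ·) → p ∈ consecutivePairs l →
      p.1 ∈ l ∧ p.2 ∈ l ∧ p.1 ≠ p.2
  | [], p, _, h => by simp [consecutivePairs] at h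
  | [_], p, _, h => by simp [consecutivePairs] at h
  | x :: y :: l, p, hl, h => by
    simp only [consecutivePairs, List.mem_cons] at h
    rcases h with rfl | h
    · simp only [List.isChain_cons_cons] at hl
      simp [hl.1]
    · have := mem_consecutivePairs l p hl.tail.tail h
      simp [this]

theorem alternation_sublist_of_count :
    ∀ (l : List ℕ) (a b k : ℕ), k ≤ (consecutivePairs l).count (a, b) →
      (alternation a b (2 * k)).Sublist l
  | l, a, b, 0, _ => by simp [alternation]
  | [], a, b, k + 1, h => by simp [consecutivePairs] at h
  | [_], a, b, k + 1, h => by simp [consecutivePairs] at h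
  | x :: y :: l, a, b, k + 1, h => by
    simp only [consecutivePairs, List.count_cons] at h
    by_cases hxy : (x, y) = (a, b)
    · obtain ⟨rfl, rfl⟩ := Prod.mk.inj hxy
      have := alternation_sublist_of_count l x y k (by simpa using h)
      exact (this.cons_cons y).cons_cons x
    · have := alternation_sublist_of_count l a b (k + 1) (by simpa [hxy] using h)
      exact (this.cons y).cons x

theorem alternation_sublist_alternation :
    ∀ (a b j k : ℕ), j ≤ k → (alternation a b j).Sublist (alternation a b k)
  | _, _, 0, _, _ => by simp [alternation]
  | a, b, j + 1, k + 1, h =>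
    (alternation_sublist_alternation b a j k (by omega)).cons_cons a

theorem length_le_of_isDavenportSchinzel (s : ℕ) (S : List ℕ) (hS : IsDavenportSchinzel s S) :
    S.length ≤ 2 * (S.toFinset.card * S.toFinset.card * (s + 1)) + 1 := by
  have h1 := length_le_consecutivePairs S
  have h2 : (consecutivePairs S).length ≤ S.toFinset.card * S.toFinset.card * (s + 1) := by
    rw [← List.sum_toFinset_count_eq_length (consecutivePairs S), ← Finset.card_product]
    refine (Finset.sum_le_card_nsmul _ _ (s + 1) ?_).trans ?_
    · rintro ⟨a, b⟩ hp
      by_contra! hlt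
      have hm := mem_consecutivePairs S (a, b) hS.1 (by simpa using hp)
      have h := hlt.le
      exact hS.2 a b hm.2.2
        ((alternation_sublist_alternation a b (s + 2) (2 * (s + 1)) (by omega)).trans
          (alternation_sublist_of_count S a b (s + 1) (h.trans_eq (by congr!))))
    · rw [smul_eq_mul]
      refine Nat.mul_le_mul_right _ (Finset.card_le_card ?_)
      rintro ⟨a, b⟩ hp
      have hm := mem_consecutivePairs S (a, b) hS.1 (by simpa using hp)
      simp [hm.1, hm.2.1]
  omega

theorem not_alternation_sublist_range (n a b k : ℕ) :
    ¬ (alternation a b (k + 3)).Sublist (List.range n) := by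
  intro h
  have h1 := List.nodup_range.sublist h
  simp [alternation] at h1

theorem isGreatest_dsLambda (s n : ℕ) (hs : 1 ≤ s) :
    IsGreatest (dsLengths s n) (dsLambda s n) := by
  have hne : (dsLengths s n).Nonempty := by
    refine ⟨n, List.range n, ⟨?_, fun a b _ => ?_⟩, ?_, by simp⟩
    · exact List.Pairwise.isChain List.nodup_range
    · obtain ⟨k, rfl⟩ := Nat.exists_eq_add_of_le' hs
      exact not_alternation_sublist_range n a b k
    · rw [List.toFinset_card_of_nodup List.nodup_range, List.length_range]
  have hb : BddAbove (dsLengths s n) := by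
    refine ⟨2 * (n * n * (s + 1)) + 1, ?_⟩
    rintro _ ⟨S, hS, rfl, rfl⟩
    exact length_le_of_isDavenportSchinzel s S hS
  exact ⟨Nat.sSup_mem hne hb, fun _ h => le_csSup hb h⟩

/-! ### The inverse Ackermann function -/

/-- The Ackermann hierarchy `A_k(n)`, `k ≥ 1`: `A_1(n) = 2n` and `A_k(n)` is the `n`-fold iterate of
`A_{k-1}` applied to `1` for `k ≥ 2`. The value at `k = 0` is arbitrary and never used. -/
def ackHierarchy : ℕ → ℕ → ℕ
  | 0, _ => 0
  | 1, n => 2 * n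
  | k + 2, n => (ackHierarchy (k + 1))^[n] 1

/-- The Ackermann function `A(n) = A_n(3)`, `n ≥ 1`. -/
def ackermann (n : ℕ) : ℕ := ackHierarchy n 3

theorem ackHierarchy_props (k : ℕ) :
    StrictMono (ackHierarchy (k + 1)) ∧ ∀ n, 1 ≤ n → n < ackHierarchy (k + 1) n := by
  induction k with
  | zero =>
    refine ⟨fun a b h => ?_, fun n hn => ?_⟩ <;> simp only [ackHierarchy] <;> omega
  | succ k ih =>
    have hsucc : ∀ n, ackHierarchy (k + 2) (n + 1)
        = ackHierarchy (k + 1) (ackHierarchy (k + 2) n) := fun n => by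
      simp only [ackHierarchy, Function.iterate_succ_apply']
    have hlt : ∀ n, n < ackHierarchy (k + 2) n := fun n => by
      induction n with
      | zero => simp [ackHierarchy]
      | succ n ihn =>
        rw [hsucc]
        have h : ackHierarchy (k + 2) n < ackHierarchy (k + 1) (ackHierarchy (k + 2) n) :=
          ih.2 _ (by omega)
        omega
    refine ⟨strictMono_nat_of_lt_succ fun n => ?_, fun n _ => hlt n⟩
    rw [hsucc]
    exact ih.2 (ackHierarchy (k + 2) n) (by have := hlt n; omega)

theorem ackHierarchy_one_two (k : ℕ) :
    ackHierarchy (k + 1) 1 = 2 ∧ ackHierarchy (k + 1) 2 = 4 := by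
  induction k with
  | zero => simp [ackHierarchy]
  | succ k ih =>
    have h1 : ackHierarchy (k + 2) 1 = ackHierarchy (k + 1) 1 := rfl
    have h2 : ackHierarchy (k + 2) 2 = ackHierarchy (k + 1) (ackHierarchy (k + 1) 1) := rfl
    exact ⟨h1.trans ih.1, by rw [h2, ih.1, ih.2]⟩

theorem lt_ackermann_succ (k : ℕ) : k < ackermann (k + 1) := by
  induction k with
  | zero => simp [ackermann, ackHierarchy]
  | succ k ih =>
    have h3 : ackermann (k + 1 + 1)
        = ackHierarchy (k + 1) (ackHierarchy (k + 1) (ackHierarchy (k + 1) 1)) := rfl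
    rw [(ackHierarchy_one_two k).1, (ackHierarchy_one_two k).2] at h3
    have h4 : ackermann (k + 1) < ackHierarchy (k + 1) 4 :=
      (ackHierarchy_props k).1 (show 3 < 4 by omega)
    omega

theorem exists_le_ackermann (x : ℕ) : ∃ k, 1 ≤ k ∧ x ≤ ackermann k :=
  ⟨x + 1, by omega, (lt_ackermann_succ x).le⟩

/-- The inverse Ackermann function `α(x) = min {k ≥ 1 | A(k) ≥ x}`. -/
def inverseAckermann (x : ℕ) : ℕ := Nat.find (exists_le_ackermann x)

/-! ### Block sequences -/

/-! Long sequences come from a recursive merging of sequences cut into repetition-free blocks. In a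
special block every symbol stands at its first or its last occurrence. The parameters are the length
`m` of the special blocks, their number `S`, and `d`, where symbols occur `2 * d` times on average.

To merge, take an outer sequence whose special blocks have length `f` and an inner one with exactly
`f` special blocks. Each special block `D` of the outer sequence receives a fresh copy of the inner
one, and the symbols of `D` are distributed over the special blocks of that copy, one into each.
First occurrences of `D` are repeated in reverse order after the copy, last occurrences in reverse
order before it. An outer symbol thus gains one occurrence at each end, so `2 * d` becomes `2 * (d +
1)`, which is the value required of the inner sequence; the special blocks grow from `m` to `m + 1`.

No `a b a b a` arises (`Block.Good.avoid_merge`). Two outer symbols only see the doubling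
`Block.expand`; the order conditions `first_pair` and `last_pair`, together with `share`, make it
harmless (`Block.Good.avoid_expand`). An outer symbol occurs at most once inside a copy and, if it
does occur there, is absent either before or after it, so it cannot alternate enough with a symbol
of the copy. Different copies occupy disjoint intervals. `Block.Good.merge` shows that all
conditions persist, so merging can be iterated from a grid of rows and columns and from empty
blocks.

The number of special blocks satisfies the Ackermann-like recursion `Block.specCount`, compared with
the hierarchy in `Block.specCount_le_ackHierarchy`. There are fewer than `2 * S` blocks, and equal
neighbours occur only at block boundaries; for `m = 1` their removal costs a constant per symbol
(`exists_dsLambda_three_ge`). Superadditivity of `dsLambda 3` carries the bound to every `n`. -/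

/-- A block of a sequence: a regular block is a list of symbols; each symbol of a special block is
tagged `true` if it is the first occurrence of the symbol in the whole sequence, and `false` if it
is the last one. -/
inductive Block (α : Type) : Type
  | reg (l : List α) : Block α
  | spec (D : List (α × Bool)) : Block α

namespace Block

/-- The symbols of a block. -/
def syms {α : Type} : Block α → List α
  | reg l => l
  | spec D => D.map Prod.fst

/-- The symbols of a list of tagged symbols which have the tag `t`. -/
def tagged {α : Type} (t : Bool) (D : List (α × Bool)) : List α :=
  (D.filter (fun x => x.2 == t)).map Prod.fst

/-- The block with the first and last occurrences of symbols in special blocks doubled. -/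
def expand {α : Type} : Block α → List α
  | reg l => l
  | spec D => (tagged false D).reverse ++ (D.map Prod.fst ++ (tagged true D).reverse)

/-- The sequence formed by a list of blocks. -/
def flat {α : Type} (Z : List (Block α)) : List α := Z.flatMap syms

/-- The conditions on a list of blocks maintained by the recursive construction. -/
structure Good {α : Type} (Z : List (Block α)) : Prop where
  nodup : ∀ B ∈ Z, B.syms.Nodup
  first : ∀ P D Q, Z = P ++ spec D :: Q → ∀ a, (a, true) ∈ D → a ∉ flat P
  last : ∀ P D Q, Z = P ++ spec D :: Q → ∀ a, (a, false) ∈ D → a ∉ flat Q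
  first_pair : ∀ P D Q, Z = P ++ spec D :: Q → ∀ a b,
    [(a, true), (b, true)].Sublist D → ¬ [b, a].Sublist (flat Q)
  last_pair : ∀ P D Q, Z = P ++ spec D :: Q → ∀ a b,
    [(a, false), (b, false)].Sublist D → ¬ [b, a].Sublist (flat P)
  share : ∀ D E a b, spec D ∈ Z → spec E ∈ Z → a ≠ b → (a, true) ∈ D → (b, true) ∈ D →
    (a, false) ∈ E → (b, false) ∈ E → False
  avoid : ∀ a b, a ≠ b → ¬ [a, b, a, b, a].Sublist (flat Z)

section
variable {α β : Type}

/-! ### Flattening, tags and sublists. -/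

theorem flat_nil : flat ([] : List (Block α)) = [] := rfl

theorem flat_cons (B : Block α) (Z : List (Block α)) : flat (B :: Z) = B.syms ++ flat Z := rfl

theorem flat_append (P Q : List (Block α)) : flat (P ++ Q) = flat P ++ flat Q :=
  List.flatMap_append

theorem mem_tagged {a : α} {t : Bool} {D : List (α × Bool)} : a ∈ tagged t D ↔ (a, t) ∈ D := by
  simp [tagged]

theorem mem_syms_spec {a : α} {D : List (α × Bool)} :
    a ∈ (spec D).syms ↔ (a, true) ∈ D ∨ (a, false) ∈ D := by
  simp [syms, or_comm]

theorem mem_expand {a : α} {B : Block α} : a ∈ B.expand ↔ a ∈ B.syms := by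
  cases B with
  | reg l => rfl
  | spec D =>
    have := mem_syms_spec (a := a) (D := D)
    simp only [expand, List.mem_append, List.mem_reverse, mem_tagged]
    change _ ∨ a ∈ (spec D).syms ∨ _ ↔ _
    tauto

theorem mem_flatMap_expand {a : α} {Z : List (Block α)} : a ∈ Z.flatMap expand ↔ a ∈ flat Z := by
  simp [flat, mem_expand]

theorem expand_spec_filter (p : α → Bool) (D : List (α × Bool)) :
    (spec D).expand.filter p = (spec (D.filter (fun x => p x.1))).expand := by
  simp only [expand, tagged, List.filter_append, List.filter_reverse, List.filter_map,
    List.filter_filter, Function.comp_def, Bool.and_comm]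

theorem filter_eq_pair {a b : α} {s t : Bool} {D : List (α × Bool)} (p : α → Bool)
    (hp : ∀ x, p x = true ↔ x = a ∨ x = b)
    (hD : (D.map Prod.fst).Nodup) (h : [(a, s), (b, t)].Sublist D) :
    D.filter (fun x => p x.1) = [(a, s), (b, t)] := by
  have h1 : [(a, s), (b, t)].Sublist (D.filter (fun x => p x.1)) := by
    have := h.filter (fun x => p x.1)
    rwa [List.filter_eq_self.2] at this
    simp [hp]
  refine (h1.eq_of_length_le ?_).symm
  have h2 : ((D.filter (fun x => p x.1)).map Prod.fst).Nodup :=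
    hD.sublist (List.filter_sublist.map _)
  have h3 : (D.filter (fun x => p x.1)).map Prod.fst ⊆ [a, b] := by
    intro x hx
    simp only [List.mem_map, List.mem_filter] at hx
    obtain ⟨y, hy, rfl⟩ := hx
    simpa [hp] using hy.2
  have h4 := (List.subperm_of_subset h2 h3).length_le
  simpa using h4

theorem sublist_of_cons_sublist_append {x : α} {l A B : List α} (h : (x :: l).Sublist (A ++ B))
    (hx : x ∉ A) : (x :: l).Sublist B := by
  induction A with
  | nil => exact h
  | cons y A ih =>
    simp only [List.mem_cons, not_or] at hx
    rw [List.cons_append, List.sublist_cons_iff] at h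
    rcases h with h | ⟨r, hr, _⟩
    · exact ih h hx.2
    · exact absurd (List.cons.inj hr).1 hx.1

theorem sublist_of_append_sublist_append {x : α} {l A B : List α}
    (h : (l ++ [x]).Sublist (A ++ B)) (hx : x ∉ B) : (l ++ [x]).Sublist A := by
  have h1 := h.reverse
  simp only [List.reverse_append, List.reverse_cons, List.reverse_nil, List.nil_append,
    List.singleton_append] at h1
  have h2 := (sublist_of_cons_sublist_append h1 (by simpa using hx)).reverse
  simpa using h2

theorem sublist_pair_of_mem {x y : α} {D : List α} (hx : x ∈ D) (hy : y ∈ D) (h : x ≠ y) :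
    [x, y].Sublist D ∨ [y, x].Sublist D := by
  obtain ⟨A, B, rfl⟩ := List.append_of_mem hx
  simp only [List.mem_append, List.mem_cons, h.symm, false_or] at hy
  rcases hy with hy | hy
  · right
    exact (List.singleton_sublist.2 hy).append (l₁ := [y]) (r₁ := [x]) (by simp)
  · left
    exact (((List.singleton_sublist.2 hy).cons_cons x).trans (List.sublist_append_right A _))

/-! ### Doubling first and last occurrences. -/

/-- Alternations in the expanded sequence come from the original one if no special block contains
two of the symbols. -/
theorem sublist_flat_of_sublist_expand {a b : α} {Z : List (Block α)}
    (hZ : ∀ D, spec D ∈ Z → ¬ (a ∈ (spec D).syms ∧ b ∈ (spec D).syms)) {l : List α}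
    (hl : l.IsChain (· ≠ ·)) (hab : ∀ x ∈ l, x = a ∨ x = b) (h : l.Sublist (Z.flatMap expand)) :
    l.Sublist (flat Z) := by
  induction Z generalizing l with
  | nil => exact h
  | cons B Z ih =>
    rw [List.flatMap_cons, List.sublist_append_iff] at h
    obtain ⟨l1, l2, rfl, h1, h2⟩ := h
    rw [flat_cons]
    rw [List.isChain_append] at hl
    refine List.Sublist.append ?_ (ih (fun D hD => hZ D (List.mem_cons_of_mem _ hD)) hl.2.1
      (fun x hx => hab x (by simp [hx])) h2)
    cases B with
    | reg l => exact h1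
    | spec D =>
      have hD := hZ D (by simp)
      have hm : ∀ x ∈ l1, x ∈ (spec D).syms := fun x hx => mem_expand.1 (h1.subset hx)
      match l1, hm, hl.1, fun x hx => hab x (List.mem_append_left l2 hx) with
      | [], _, _, _ => simp
      | [x], hm, _, _ => exact List.singleton_sublist.2 (hm x (by simp))
      | x :: y :: l, hm, hc, hab =>
        have hxy : x ≠ y := (List.isChain_cons_cons.1 hc).1
        have hx := hm x (by simp)
        have hy := hm y (by simp)
        rcases hab x (by simp) with rfl | rfl <;> rcases hab y (by simp) with rfl | rfl <;>
          tauto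

/-- The shape seen by two symbols whose first occurrences share a special block: `a b`, then the
reversed repetition `b a`. Because of the reversal, either alternation of length 5 would need `b a`
in the remainder `u`. -/
theorem not_sublist_abba_append {a b : α} (hab : a ≠ b) {u : List α} (hu : ¬ [b, a].Sublist u) :
    ¬ [a, b, a, b, a].Sublist (a :: b :: b :: a :: u) ∧
      ¬ [b, a, b, a, b].Sublist (a :: b :: b :: a :: u) := by
  have hba := hab.symm
  constructor
  · intro h
    rw [List.cons_sublist_cons, List.cons_sublist_cons] at h
    have h := sublist_of_cons_sublist_append (A := [b]) h (by simpa using hab)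
    rw [List.cons_sublist_cons] at h
    exact hu h
  · intro h
    have h := sublist_of_cons_sublist_append (A := [a]) h (by simpa using hba)
    rw [List.cons_sublist_cons] at h
    have h := sublist_of_cons_sublist_append (A := [b]) h (by simpa using hab)
    rw [List.cons_sublist_cons] at h
    exact hu (List.Sublist.trans (by simp) h)

theorem not_sublist_append_baab {a b : α} (hab : a ≠ b) {u : List α} (hu : ¬ [b, a].Sublist u) :
    ¬ [a, b, a, b, a].Sublist (u ++ [b, a, a, b]) ∧
      ¬ [b, a, b, a, b].Sublist (u ++ [b, a, a, b]) := by
  have h1 : ¬ [a, b].Sublist u.reverse := fun h => hu (by simpa using h.reverse)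
  have h2 := not_sublist_abba_append hab.symm h1
  exact ⟨fun h => h2.2 (by simpa using h.reverse), fun h => h2.1 (by simpa using h.reverse)⟩

/-- The shape seen when one symbol begins and the other ends in the same special block: each outer
part lacks one of them, so four terms of the alternation are forced into `M`. -/
theorem not_sublist_append_append {a b : α} {u v M : List α} (hu : b ∉ u) (hv : a ∉ v)
    (hM : ¬ [b, a, b, a].Sublist M) :
    ¬ [a, b, a, b, a].Sublist (u ++ M ++ v) ∧ ¬ [b, a, b, a, b].Sublist (u ++ M ++ v) := by
  constructor
  · intro h
    have h := sublist_of_append_sublist_append (l := [a, b, a, b]) h hv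
    have h : [b, a, b, a].Sublist (u ++ M) := (List.sublist_cons_self _ _).trans h
    exact hM (sublist_of_cons_sublist_append h hu)
  · intro h
    rw [List.append_assoc] at h
    have h := sublist_of_cons_sublist_append h hu
    have h : ([b, a, b] ++ [a]).Sublist (M ++ v) := List.Sublist.trans (by simp) h
    exact hM (sublist_of_append_sublist_append h hv)

/-- Restricting to the two symbols turns the expansion of `D` into an explicit word of length 4, and
the four tag combinations can be settled separately. -/
theorem Good.avoid_expand_of_sublist {Z P Q : List (Block α)} {D : List (α × Bool)} (hZ : Good Z)
    (hPQ : Z = P ++ spec D :: Q) {a b : α} {s t : Bool} (hab : a ≠ b)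
    (hD : [(a, s), (b, t)].Sublist D) :
    ¬ [a, b, a, b, a].Sublist (Z.flatMap expand) ∧
      ¬ [b, a, b, a, b].Sublist (Z.flatMap expand) := by
  classical
  let p : α → Bool := fun x => decide (x = a ∨ x = b)
  have hp : ∀ x, p x = true ↔ x = a ∨ x = b := fun x => by simp [p]
  have haD : (a, s) ∈ D := hD.subset (by simp)
  have hbD : (b, t) ∈ D := hD.subset (by simp)
  have hnd : (D.map Prod.fst).Nodup := hZ.nodup (spec D) (by simp [hPQ])
  have hf : (Z.flatMap expand).filter p = (P.flatMap expand).filter p ++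
      (spec [(a, s), (b, t)]).expand ++ (Q.flatMap expand).filter p := by
    rw [hPQ, List.flatMap_append, List.flatMap_cons, List.filter_append, List.filter_append,
      expand_spec_filter, filter_eq_pair p hp hnd hD, List.append_assoc]
  have key : ∀ l : List α, (∀ x ∈ l, x = a ∨ x = b) → l.Sublist (Z.flatMap expand) →
      l.Sublist ((P.flatMap expand).filter p ++
      (spec [(a, s), (b, t)]).expand ++ (Q.flatMap expand).filter p) := by
    intro l hl h
    have := h.filter p
    rwa [hf, List.filter_eq_self.2 (fun x hx => (hp x).2 (hl x hx))] at this
  have hmemD : ∀ {x : α} {r : Bool}, (x, r) ∈ D → x ∈ (spec D).syms := fun h =>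
    List.mem_map_of_mem h
  suffices hs : ¬ [a, b, a, b, a].Sublist ((P.flatMap expand).filter p ++
      (spec [(a, s), (b, t)]).expand ++ (Q.flatMap expand).filter p) ∧
      ¬ [b, a, b, a, b].Sublist ((P.flatMap expand).filter p ++
      (spec [(a, s), (b, t)]).expand ++ (Q.flatMap expand).filter p) from
    ⟨fun h => hs.1 (key _ (by simp) h), fun h => hs.2 (key _ (by simp) h)⟩
  have hnotP : ∀ x, (x, true) ∈ D → x ∉ P.flatMap expand := fun x hx => by
    rw [mem_flatMap_expand]; exact hZ.first P D Q hPQ x hx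
  have hnotQ : ∀ x, (x, false) ∈ D → x ∉ Q.flatMap expand := fun x hx => by
    rw [mem_flatMap_expand]; exact hZ.last P D Q hPQ x hx
  cases s <;> cases t
  · have hQ : (Q.flatMap expand).filter p = [] := by
      rw [List.filter_eq_nil_iff]
      intro x hx
      rw [hp]
      rintro (rfl | rfl)
      exacts [hnotQ _ haD hx, hnotQ _ hbD hx]
    rw [hQ, List.append_nil]
    refine not_sublist_append_baab hab fun h => ?_
    refine hZ.last_pair P D Q hPQ a b hD (sublist_flat_of_sublist_expand (a := a) (b := b) ?_
      (by simpa using hab.symm) (by simp) (h.trans List.filter_sublist))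
    -- An earlier special block containing both symbols would hold either two first occurrences,
    -- against `share`, or a last occurrence of a symbol that recurs in `D`.
    rintro E hE ⟨ha, hb⟩
    obtain ⟨P1, P2, rfl⟩ := List.append_of_mem hE
    have hl := hZ.last P1 E (P2 ++ spec D :: Q) (by simp [hPQ])
    rw [mem_syms_spec] at ha hb
    rcases ha with ha | ha
    · rcases hb with hb | hb
      · exact hZ.share E D a b (by simp [hPQ]) (by simp [hPQ]) hab ha hb haD hbD
      · exact hl b hb (by simp [flat_append, flat_cons, hmemD hbD])
    · exact hl a ha (by simp [flat_append, flat_cons, hmemD haD])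
  · refine not_sublist_append_append ?_ ?_ ?_
    · exact fun h => hnotP b hbD (List.mem_of_mem_filter h)
    · exact fun h => hnotQ a haD (List.mem_of_mem_filter h)
    -- Here the word is `a a b b`; with the two tags exchanged it is `b a b a`, which still contains
    -- no `a b a b`.
    · simp [expand, tagged, hab, hab.symm, List.sublist_cons_iff]
  · refine (not_sublist_append_append ?_ ?_ ?_).symm
    · exact fun h => hnotP a haD (List.mem_of_mem_filter h)
    · exact fun h => hnotQ b hbD (List.mem_of_mem_filter h)
    · simp [expand, tagged, hab, hab.symm, List.sublist_cons_iff]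
  · have hP : (P.flatMap expand).filter p = [] := by
      rw [List.filter_eq_nil_iff]
      intro x hx
      rw [hp]
      rintro (rfl | rfl)
      exacts [hnotP _ haD hx, hnotP _ hbD hx]
    rw [hP, List.nil_append]
    refine not_sublist_abba_append hab fun h => ?_
    refine hZ.first_pair P D Q hPQ a b hD (sublist_flat_of_sublist_expand (a := a) (b := b) ?_
      (by simpa using hab.symm) (by simp) (h.trans List.filter_sublist))
    rintro E hE ⟨ha, hb⟩
    obtain ⟨P1, P2, rfl⟩ := List.append_of_mem hE
    have hl := hZ.first (P ++ spec D :: P1) E P2 (by simp [hPQ])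
    rw [mem_syms_spec] at ha hb
    rcases ha with ha | ha
    · exact hl a ha (by simp [flat_append, flat_cons, hmemD haD])
    · rcases hb with hb | hb
      · exact hl b hb (by simp [flat_append, flat_cons, hmemD hbD])
      · exact hZ.share D E a b (by simp [hPQ]) (by simp [hPQ]) hab haD hbD ha hb

/-- Doubling the first and last occurrences as in `Block.expand` creates no forbidden pattern. -/
theorem Good.avoid_expand {Z : List (Block α)} (hZ : Good Z) {a b : α} (hab : a ≠ b) :
    ¬ [a, b, a, b, a].Sublist (Z.flatMap expand) := by
  by_cases hs : ∃ D, spec D ∈ Z ∧ a ∈ (spec D).syms ∧ b ∈ (spec D).syms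
  · obtain ⟨D, hD, ha, hb⟩ := hs
    obtain ⟨P, Q, hPQ⟩ := List.append_of_mem hD
    simp only [syms, List.mem_map] at ha hb
    obtain ⟨⟨a, s⟩, ha, rfl⟩ := ha
    obtain ⟨⟨b, t⟩, hb, rfl⟩ := hb
    rcases sublist_pair_of_mem ha hb (by simp_all) with h | h
    · exact (hZ.avoid_expand_of_sublist hPQ hab h).1
    · exact (hZ.avoid_expand_of_sublist hPQ (Ne.symm hab) h).2
  · push Not at hs
    intro h
    refine hZ.avoid a b hab (sublist_flat_of_sublist_expand (a := a) (b := b) ?_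
      (by simp [hab, hab.symm]) (by simp) h)
    exact fun D hD hab => hs D hD hab.1 hab.2

/-! ### The merge operation and its projections. -/

/-- The symbols of a merged sequence: those of the outer sequence, and those of the copies of the
inner sequence, one copy for each special block of the outer sequence. -/
abbrev MergeSym (α β : Type) : Type := α ⊕ (List (α × Bool) × β)

/-- The symbol `c` in the copy of the inner sequence with label `K`. -/
def copySym (K : List (α × Bool)) (c : β) : MergeSym α β := Sum.inr (K, c)

/-- The tagged symbol `x` in the copy of the inner sequence with label `K`. -/
def copyTag (K : List (α × Bool)) (x : β × Bool) : MergeSym α β × Bool := (copySym K x.1, x.2)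

/-- Insert a symbol into a special block: at the end if it is a first occurrence, and at the
beginning if it is a last occurrence. -/
def addTag : α × Bool → List (MergeSym α β × Bool) → List (MergeSym α β × Bool)
  | (a, true), E => E ++ [(Sum.inl a, true)]
  | (a, false), E => (Sum.inl a, false) :: E

/-- A copy with label `K` of a list of blocks, with the tagged symbols of `D` inserted, one into
each special block. -/
def insertTags (K : List (α × Bool)) :
    List (α × Bool) → List (Block β) → List (Block (MergeSym α β))
  | _, [] => []
  | D, reg l :: Z => reg (l.map (copySym K)) :: insertTags K D Z
  | [], spec E :: Z => spec (E.map (copyTag K)) :: insertTags K [] Z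
  | d :: D, spec E :: Z => spec (addTag d (E.map (copyTag K))) :: insertTags K D Z

/-- The blocks which replace a block of the outer sequence. -/
def mergeBlock (Z' : List (Block β)) : Block α → List (Block (MergeSym α β))
  | reg l => [reg (l.map Sum.inl)]
  | spec D => reg ((tagged false D).reverse.map Sum.inl) ::
      (insertTags D D Z' ++ [reg ((tagged true D).reverse.map Sum.inl)])

/-- The merged sequence: each special block of the outer sequence `Z` is merged with a copy of the
inner sequence `Z'`. -/
def merge (Z : List (Block α)) (Z' : List (Block β)) : List (Block (MergeSym α β)) :=
  Z.flatMap (mergeBlock Z')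

/-- The number of special blocks. -/
def numSpec : List (Block α) → ℕ
  | [] => 0
  | reg _ :: Z => numSpec Z
  | spec _ :: Z => numSpec Z + 1

theorem numSpec_append (P Q : List (Block α)) : numSpec (P ++ Q) = numSpec P + numSpec Q := by
  induction P with
  | nil => simp [numSpec]
  | cons B P ih => cases B <;> simp [numSpec, ih]; omega

/-- The outer symbols of a merged sequence. -/
def outer : MergeSym α β → Option α
  | Sum.inl a => some a
  | Sum.inr _ => none

open Classical in
/-- The symbols of the copy with label `K` in a merged sequence. -/
noncomputable def inner (K : List (α × Bool)) : MergeSym α β → Option β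
  | Sum.inl _ => none
  | Sum.inr (K', c) => if K' = K then some c else none

theorem mem_addTag {d : α × Bool} {E : List (MergeSym α β × Bool)} {x : MergeSym α β × Bool} :
    x ∈ addTag d E ↔ x = (Sum.inl d.1, d.2) ∨ x ∈ E := by
  obtain ⟨a, _ | _⟩ := d <;> simp [addTag, or_comm]

theorem filterMap_outer_copySym (K : List (α × Bool)) (l : List β) :
    (l.map (copySym K)).filterMap outer = [] := by
  simp [outer, copySym]

theorem filterMap_inner_copySym (K : List (α × Bool)) (l : List β) :
    (l.map (copySym K)).filterMap (inner K) = l := by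
  rw [List.filterMap_map]
  have h : inner K ∘ (copySym K : β → MergeSym α β) = some := by
    funext c
    simp [inner, copySym]
  rw [h, List.filterMap_some]

theorem filterMap_outer_inl (l : List α) :
    (l.map (Sum.inl : α → MergeSym α β)).filterMap outer = l := by
  rw [List.filterMap_map]
  exact List.filterMap_some

theorem map_fst_copyTag (K : List (α × Bool)) (E : List (β × Bool)) :
    (E.map (copyTag K)).map Prod.fst = (E.map Prod.fst).map (copySym K) := by
  simp [copyTag, Function.comp_def]

theorem outer_addTag (K : List (α × Bool)) (d : α × Bool) (E : List (β × Bool)) :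
    ((addTag d (E.map (copyTag K))).map Prod.fst).filterMap outer = [d.1] := by
  obtain ⟨a, _ | _⟩ := d <;>
    simp only [addTag, List.map_cons, List.map_append, map_fst_copyTag, List.filterMap_append,
      List.filterMap_cons, filterMap_outer_copySym] <;> rfl

theorem inner_addTag (K : List (α × Bool)) (d : α × Bool) (E : List (β × Bool)) :
    ((addTag d (E.map (copyTag K))).map Prod.fst).filterMap (inner K) = E.map Prod.fst := by
  obtain ⟨a, _ | _⟩ := d <;>
    simp only [addTag, List.map_cons, List.map_append, map_fst_copyTag, List.filterMap_append,
      List.filterMap_cons, filterMap_inner_copySym] <;> simp [inner]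

theorem outer_insertTags (K D : List (α × Bool)) (Z : List (Block β)) (h : D.length ≤ numSpec Z) :
    (flat (insertTags K D Z)).filterMap outer = D.map Prod.fst := by
  induction Z generalizing D with
  | nil =>
    obtain rfl : D = [] := by simpa [numSpec] using h
    rfl
  | cons B Z ih =>
    cases B with
    | reg l =>
      rw [insertTags, flat_cons, List.filterMap_append, ih D h]
      rw [syms, filterMap_outer_copySym]
      rfl
    | spec E =>
      cases D with
      | nil =>
        rw [insertTags, flat_cons, List.filterMap_append, ih [] (by simp)]
        rw [syms, map_fst_copyTag, filterMap_outer_copySym]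
        rfl
      | cons d D =>
        rw [insertTags, flat_cons, List.filterMap_append, ih D (by simpa [numSpec] using h), syms,
          outer_addTag]
        rfl

theorem inner_insertTags (K D : List (α × Bool)) (Z : List (Block β)) :
    (flat (insertTags K D Z)).filterMap (inner K) = flat Z := by
  induction Z generalizing D with
  | nil => rfl
  | cons B Z ih =>
    cases B with
    | reg l =>
      rw [insertTags, flat_cons, List.filterMap_append, ih D, flat_cons]
      rw [syms, filterMap_inner_copySym]
      rfl
    | spec E =>
      cases D with
      | nil =>
        rw [insertTags, flat_cons, List.filterMap_append, ih [], flat_cons, syms,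
          map_fst_copyTag, filterMap_inner_copySym]
        rfl
      | cons d D =>
        rw [insertTags, flat_cons, List.filterMap_append, ih D, syms, inner_addTag]
        rfl

theorem mem_filterMap_outer {a : α} {W : List (MergeSym α β)} :
    a ∈ W.filterMap outer ↔ Sum.inl a ∈ W := by
  rw [List.mem_filterMap]
  constructor
  · rintro ⟨x | x, hx, h⟩
    · cases h; exact hx
    · cases h
  · exact fun h => ⟨_, h, rfl⟩

theorem mem_filterMap_inner {K : List (α × Bool)} {c : β} {W : List (MergeSym α β)} :
    c ∈ W.filterMap (inner K) ↔ copySym K c ∈ W := by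
  rw [List.mem_filterMap]
  constructor
  · rintro ⟨x | ⟨K', c'⟩, hx, h⟩
    · cases h
    · by_cases hK : K' = K
      · subst hK
        simp only [inner, if_true, Option.some.injEq] at h
        subst h
        exact hx
      · simp [inner, hK] at h
  · exact fun h => ⟨_, h, by simp [inner, copySym]⟩

theorem label_of_mem_insertTags {K K' D : List (α × Bool)} {Z : List (Block β)} {c : β}
    (h : Sum.inr (K', c) ∈ flat (insertTags K D Z)) : K' = K := by
  induction Z generalizing D with
  | nil => simp [insertTags, flat] at h
  | cons B Z ih =>
    cases B with
    | reg l =>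
      rw [insertTags, flat_cons, List.mem_append] at h
      rcases h with h | h
      · simp only [syms, copySym, List.mem_map, Sum.inr.injEq, Prod.mk.injEq] at h
        tauto
      · exact ih h
    | spec E =>
      cases D with
      | nil =>
        rw [insertTags, flat_cons, List.mem_append] at h
        rcases h with h | h
        · simp only [syms, map_fst_copyTag, copySym, List.mem_map, Sum.inr.injEq,
            Prod.mk.injEq] at h
          tauto
        · exact ih h
      | cons d D =>
        rw [insertTags, flat_cons, List.mem_append] at h
        rcases h with h | h
        · simp only [syms, copyTag, copySym, List.mem_map, mem_addTag] at h
          obtain ⟨x, rfl | ⟨y, _, rfl⟩, hx⟩ := h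
          · cases hx
          · simp only [Sum.inr.injEq, Prod.mk.injEq] at hx
            tauto
        · exact ih h

theorem outer_mergeBlock (Z' : List (Block β)) (B : Block α)
    (h : ∀ D, B = spec D → D.length ≤ numSpec Z') :
    (flat (mergeBlock Z' B)).filterMap outer = B.expand := by
  cases B with
  | reg l =>
    simp only [mergeBlock, flat_cons, syms, filterMap_outer_inl, expand, flat_nil,
      List.append_nil]
  | spec D =>
    simp only [mergeBlock, flat_cons, flat_append, List.filterMap_append, expand]
    rw [outer_insertTags _ _ _ (h D rfl)]
    simp only [syms, filterMap_outer_inl, flat_nil, List.filterMap_nil, List.append_nil]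

theorem merge_cons (B : Block α) (Z : List (Block α)) (Z' : List (Block β)) :
    merge (B :: Z) Z' = mergeBlock Z' B ++ merge Z Z' := rfl

theorem merge_append (P Q : List (Block α)) (Z' : List (Block β)) :
    merge (P ++ Q) Z' = merge P Z' ++ merge Q Z' := List.flatMap_append

/-- This is where `expand` comes from: the copies vanish under the projection, and only the doubled
occurrences remain. -/
theorem outer_merge (Z : List (Block α)) (Z' : List (Block β))
    (h : ∀ D, spec D ∈ Z → D.length ≤ numSpec Z') :
    (flat (merge Z Z')).filterMap outer = Z.flatMap expand := by
  induction Z with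
  | nil => rfl
  | cons B Z ih =>
    rw [merge_cons, flat_append, List.filterMap_append, ih fun D hD => h D (by simp [hD]),
      outer_mergeBlock _ _ fun D hD => h D (by simp [hD]), List.flatMap_cons]

theorem inl_mem_merge {Z : List (Block α)} {Z' : List (Block β)}
    (h : ∀ D, spec D ∈ Z → D.length ≤ numSpec Z') {a : α} :
    Sum.inl a ∈ flat (merge Z Z') ↔ a ∈ flat Z := by
  rw [← mem_filterMap_outer, outer_merge Z Z' h, mem_flatMap_expand]

theorem copySym_mem_mergeBlock {K : List (α × Bool)} {c : β} {B : Block α} {Z' : List (Block β)}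
    (h : copySym K c ∈ flat (mergeBlock Z' B)) : B = spec K ∧ c ∈ flat Z' := by
  cases B with
  | reg l => simp [mergeBlock, flat, syms, copySym] at h
  | spec D =>
    simp only [mergeBlock, flat_cons, flat_append, List.mem_append] at h
    rcases h with h | h | h | h
    · simp [syms, copySym] at h
    · have := label_of_mem_insertTags h
      subst this
      rw [← mem_filterMap_inner, inner_insertTags] at h
      exact ⟨rfl, h⟩
    · simp [syms, copySym] at h
    · simp [flat] at h

theorem copySym_mem_merge {K : List (α × Bool)} {c : β} {Z : List (Block α)} {Z' : List (Block β)}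
    (h : copySym K c ∈ flat (merge Z Z')) : spec K ∈ Z ∧ c ∈ flat Z' := by
  induction Z with
  | nil => simp [merge, flat] at h
  | cons B Z ih =>
    rw [merge_cons, flat_append, List.mem_append] at h
    rcases h with h | h
    · have := copySym_mem_mergeBlock h
      simp [this.1, this.2]
    · have := ih h
      simp [this.1, this.2]

/-- The blocks of `insertTags` which are special. -/
theorem insertTags_eq_append {K D : List (α × Bool)} {Z : List (Block β)}
    {p q : List (Block (MergeSym α β))} {E : List (MergeSym α β × Bool)}
    (hD : D.length = numSpec Z) (h : insertTags K D Z = p ++ spec E :: q) :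
    ∃ P E' Q D1 d D2, Z = P ++ spec E' :: Q ∧ D = D1 ++ d :: D2 ∧ D1.length = numSpec P ∧
      D2.length = numSpec Q ∧ E = addTag d (E'.map (copyTag K)) ∧
      p = insertTags K D1 P ∧ q = insertTags K D2 Q := by
  induction Z generalizing D p with
  | nil => simp [insertTags] at h
  | cons B Z ih =>
    cases B with
    | reg l =>
      rw [insertTags, List.cons_eq_append_iff] at h
      rcases h with ⟨_, h⟩ | ⟨p', rfl, h⟩
      · simp at h
      · obtain ⟨P, E', Q, D1, d, D2, rfl, rfl, h1, h2, rfl, rfl, rfl⟩ := ih hD h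
        exact ⟨reg l :: P, E', Q, D1, d, D2, rfl, rfl, h1, h2, rfl, by rw [insertTags], rfl⟩
    | spec F =>
      cases D with
      | nil => simp [numSpec] at hD
      | cons d D =>
        simp only [numSpec, List.length_cons, Nat.add_right_cancel_iff] at hD
        rw [insertTags, List.cons_eq_append_iff] at h
        rcases h with ⟨rfl, h⟩ | ⟨p', rfl, h⟩
        · simp only [List.cons.injEq, spec.injEq] at h
          exact ⟨[], F, Z, [], d, D, rfl, rfl, rfl, hD, h.1, rfl, h.2⟩
        · obtain ⟨P, E', Q, D1, d', D2, rfl, rfl, h1, h2, rfl, rfl, rfl⟩ := ih hD h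
          exact ⟨spec F :: P, E', Q, d :: D1, d', D2, rfl, rfl, by simp [numSpec, h1], h2, rfl,
            by rw [insertTags], rfl⟩

theorem merge_eq_append {Z : List (Block α)} {Z' : List (Block β)}
    {p q : List (Block (MergeSym α β))} {E : List (MergeSym α β × Bool)}
    (h : merge Z Z' = p ++ spec E :: q) :
    ∃ P D Q p' q', Z = P ++ spec D :: Q ∧ insertTags D D Z' = p' ++ spec E :: q' ∧
      p = merge P Z' ++ reg ((tagged false D).reverse.map Sum.inl) :: p' ∧
      q = q' ++ reg ((tagged true D).reverse.map Sum.inl) :: merge Q Z' := by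
  induction Z generalizing p with
  | nil => simp [merge] at h
  | cons B Z ih =>
    have step : ∀ p', merge Z Z' = p' ++ spec E :: q → p = mergeBlock Z' B ++ p' →
        ∃ P D Q p' q', B :: Z = P ++ spec D :: Q ∧ insertTags D D Z' = p' ++ spec E :: q' ∧
        p = merge P Z' ++ reg ((tagged false D).reverse.map Sum.inl) :: p' ∧
        q = q' ++ reg ((tagged true D).reverse.map Sum.inl) :: merge Q Z' := by
      intro p' h hp
      obtain ⟨P, D, Q, p'', q', rfl, h1, rfl, rfl⟩ := ih h
      exact ⟨B :: P, D, Q, p'', q', rfl, h1, by rw [hp, merge_cons, List.append_assoc], rfl⟩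
    rw [merge_cons, List.append_eq_append_iff] at h
    rcases h with ⟨p', hp, h⟩ | ⟨q', hB, hq⟩
    · exact step p' h hp
    · rw [List.cons_eq_append_iff] at hq
      rcases hq with ⟨rfl, hq⟩ | ⟨q'', rfl, hq⟩
      · exact step [] (by rw [hq, List.nil_append]) (by simpa using hB.symm)
      · cases B with
        | reg l =>
          rw [mergeBlock, List.cons_eq_append_iff] at hB
          rcases hB with ⟨_, hB⟩ | ⟨p', _, hB⟩
          · simp at hB
          · simp at hB
        | spec D =>
          rw [mergeBlock, List.cons_eq_append_iff] at hB
          rcases hB with ⟨_, hB⟩ | ⟨p', rfl, hB⟩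
          · simp at hB
          · rw [List.append_eq_append_iff] at hB
            rcases hB with ⟨r, _, hB⟩ | ⟨r, hB, hr⟩
            · rw [List.cons_eq_append_iff] at hB
              rcases hB with ⟨_, hB⟩ | ⟨_, _, hB⟩ <;> simp at hB
            · rw [List.cons_eq_append_iff] at hr
              rcases hr with ⟨_, hr⟩ | ⟨r', rfl, hr⟩
              · simp at hr
              · exact ⟨[], D, Z, p', r', rfl, hB, rfl, by rw [hq, hr, List.append_assoc]; rfl⟩

/-! ### Separation of the copies, and avoidance in the merged sequence. -/

theorem not_mem_both_tags {D : List (α × Bool)} (hD : (D.map Prod.fst).Nodup) {a : α}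
    (h1 : (a, true) ∈ D) (h2 : (a, false) ∈ D) : False := by
  have := List.inj_on_of_nodup_map hD h1 h2 rfl
  simp at this

/-- Justifies labelling a copy by the contents of its block: repeating the block would repeat a
first or last occurrence. Only empty blocks could recur. -/
theorem Good.spec_notMem {Z P Q : List (Block α)} {D : List (α × Bool)} (hZ : Good Z)
    (hPQ : Z = P ++ spec D :: Q) (hD : D ≠ []) : spec D ∉ P ∧ spec D ∉ Q := by
  obtain ⟨⟨a, t⟩, ha⟩ := List.exists_mem_of_ne_nil D hD
  have ha' : a ∈ (spec D).syms := List.mem_map_of_mem ha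
  constructor <;> intro h <;> obtain ⟨R, S, rfl⟩ := List.append_of_mem h <;> cases t
  · exact hZ.last R D (S ++ spec D :: Q) (by simp [hPQ]) a ha
      (by simp [flat_append, flat_cons, ha'])
  · exact hZ.first _ D Q hPQ a ha (by simp [flat_append, flat_cons, ha'])
  · exact hZ.last P D _ hPQ a ha (by simp [flat_append, flat_cons, ha'])
  · exact hZ.first (P ++ spec D :: R) D S (by simp [hPQ]) a ha
      (by simp [flat_append, flat_cons, ha'])

theorem filterMap_inner_eq_nil {K : List (α × Bool)} {W : List (MergeSym α β)}
    (h : ∀ c, copySym K c ∉ W) : W.filterMap (inner K) = [] := by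
  rw [List.eq_nil_iff_forall_not_mem]
  exact fun c hc => h c (mem_filterMap_inner.1 hc)

theorem flat_merge_append (P Q : List (Block α)) (D : List (α × Bool)) (Z' : List (Block β)) :
    flat (merge (P ++ spec D :: Q) Z') =
      (flat (merge P Z') ++ (tagged false D).reverse.map Sum.inl) ++
        (flat (insertTags D D Z') ++
          ((tagged true D).reverse.map Sum.inl ++ flat (merge Q Z'))) := by
  simp only [merge_append, merge_cons, mergeBlock, flat_append, flat_cons, flat_nil, syms,
    List.append_assoc, List.append_nil]

theorem copySym_notMem_map_inl {K : List (α × Bool)} {c : β} {l : List α} :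
    copySym K c ∉ l.map Sum.inl := by
  simp [copySym]

theorem Good.copySym_notMem {Z P Q : List (Block α)} {D : List (α × Bool)} {Z' : List (Block β)}
    (hZ : Good Z) (hPQ : Z = P ++ spec D :: Q) (hD : D ≠ []) (c : β) :
    copySym D c ∉ flat (merge P Z') ++ (tagged false D).reverse.map Sum.inl ∧
      copySym D c ∉ (tagged true D).reverse.map Sum.inl ++ flat (merge Q Z') := by
  have h := hZ.spec_notMem hPQ hD
  simp only [List.mem_append, not_or]
  exact ⟨⟨fun h' => h.1 (copySym_mem_merge h').1, copySym_notMem_map_inl⟩,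
    copySym_notMem_map_inl, fun h' => h.2 (copySym_mem_merge h').1⟩

/-- Each copy of the inner sequence in the merged one is the inner sequence. -/
theorem Good.inner_merge {Z : List (Block α)} {Z' : List (Block β)} (hZ : Good Z)
    (hne : ∀ D, spec D ∈ Z → D ≠ []) (K : List (α × Bool)) :
    ((flat (merge Z Z')).filterMap (inner K)).Sublist (flat Z') := by
  by_cases hK : spec K ∈ Z
  · obtain ⟨P, Q, hPQ⟩ := List.append_of_mem hK
    have h := hZ.copySym_notMem (Z' := Z') hPQ (hne K hK)
    have h1 := filterMap_inner_eq_nil fun c => (h c).1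
    have h2 := filterMap_inner_eq_nil fun c => (h c).2
    rw [hPQ, flat_merge_append]
    generalize flat (merge P Z') ++ _ = A at h1 ⊢
    generalize _ ++ flat (merge Q Z') = B at h2 ⊢
    rw [List.filterMap_append, List.filterMap_append, h1, h2, inner_insertTags, List.append_nil,
      List.nil_append]
  · rw [filterMap_inner_eq_nil fun c hc => hK (copySym_mem_merge hc).1]
    exact List.nil_sublist _

theorem inner_some (K : List (α × Bool)) (c : β) : inner K (copySym K c) = some c := by
  simp [inner, copySym]

/-- A sublist of the merged sequence which starts and ends with symbols of the same copy of the
inner sequence is a sublist of the part containing this copy. -/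
theorem Good.sublist_insertTags {Z : List (Block α)} {Z' : List (Block β)} (hZ : Good Z)
    (hne : ∀ D, spec D ∈ Z → D ≠ []) {K : List (α × Bool)} {c : β} {l : List (MergeSym α β)}
    (h : (copySym K c :: (l ++ [copySym K c])).Sublist (flat (merge Z Z'))) :
    (copySym K c :: (l ++ [copySym K c])).Sublist (flat (insertTags K K Z')) := by
  have hK := (copySym_mem_merge (h.subset List.mem_cons_self)).1
  obtain ⟨P, Q, hPQ⟩ := List.append_of_mem hK
  have hn := hZ.copySym_notMem (Z' := Z') hPQ (hne K hK) c
  rw [hPQ, flat_merge_append] at h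
  have h := sublist_of_cons_sublist_append h hn.1
  rw [← List.cons_append] at h
  exact sublist_of_append_sublist_append h hn.2

theorem Good.avoid_merge {Z : List (Block α)} {Z' : List (Block β)} (hZ : Good Z) (hZ' : Good Z')
    (hlen : ∀ D, spec D ∈ Z → D.length = numSpec Z') (hpos : 0 < numSpec Z')
    (x y : MergeSym α β) (hxy : x ≠ y) : ¬ [x, y, x, y, x].Sublist (flat (merge Z Z')) := by
  intro h
  have hle : ∀ D, spec D ∈ Z → D.length ≤ numSpec Z' := fun D hD => (hlen D hD).le
  have hne : ∀ D, spec D ∈ Z → D ≠ [] := fun D hD =>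
    List.ne_nil_of_length_pos ((hlen D hD).symm ▸ hpos)
  -- The contradiction in every mixed case: an outer symbol enters a copy at most once.
  have haa : ∀ K a, spec K ∈ Z →
      ¬ ([Sum.inl a, Sum.inl a] : List (MergeSym α β)).Sublist (flat (insertTags K K Z')) := by
    intro K a hK h
    have h := h.filterMap outer
    rw [outer_insertTags _ _ _ (hle K hK)] at h
    simpa [outer] using (hZ.nodup _ hK).sublist h
  have hmix : ∀ K c z, z ≠ copySym K c → [copySym K c, z, copySym K c].Sublist
      (flat (merge Z Z')) → (∃ a, z = Sum.inl a ∧ a ∈ (spec K).syms) ∨ (∃ c', z = copySym K c') := by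
    intro K c z hz h
    have hK := (copySym_mem_merge (h.subset List.mem_cons_self)).1
    have h := hZ.sublist_insertTags hne (l := [z]) h
    have hzm : z ∈ flat (insertTags K K Z') := h.subset (by simp)
    rcases z with a | ⟨K', c'⟩
    · refine Or.inl ⟨a, rfl, ?_⟩
      rw [← mem_filterMap_outer, outer_insertTags _ _ _ (hle K hK)] at hzm
      exact hzm
    · have := label_of_mem_insertTags hzm
      subst this
      exact Or.inr ⟨c', rfl⟩
  have hcopy : ∀ K c c', c ≠ c' → ¬ [copySym K c, copySym K c', copySym K c, copySym K c',
      copySym K c].Sublist (flat (merge Z Z')) := by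
    intro K c c' hc h
    have h := (h.filterMap (inner K)).trans (hZ.inner_merge hne K)
    simp only [List.filterMap_cons, inner_some, List.filterMap_nil] at h
    exact hZ'.avoid c c' hc h
  rcases x with a | ⟨K, c⟩
  · rcases y with b | ⟨K, c⟩
    · have h := h.filterMap outer
      rw [outer_merge Z Z' hle] at h
      exact hZ.avoid_expand (fun hab => hxy (by rw [hab])) h
    · have hK := (copySym_mem_merge (K := K) (c := c) (h.subset (by simp [copySym]))).1
      rcases hmix K c _ hxy (List.Sublist.trans (by simp [copySym]) h) with
        ⟨a', ha', ha⟩ | ⟨c', hc'⟩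
      · obtain rfl := Sum.inl.inj ha'
        obtain ⟨P, Q, hPQ⟩ := List.append_of_mem hK
        have hn := hZ.copySym_notMem (Z' := Z') hPQ (hne K hK) c
        have hnd := hZ.nodup _ hK
        rw [hPQ, flat_merge_append] at h
        rw [mem_syms_spec] at ha
        rcases ha with ha | ha
        -- If `a` starts in `K`, it is absent before the copy, while `c` is absent after it; hence
        -- `a c a c` lies inside the copy. The case of a last occurrence is the mirror image.
        · have h := sublist_of_cons_sublist_append h (by
            simp only [List.mem_append, List.mem_map, List.mem_reverse, mem_tagged, not_or]
            refine ⟨fun h' => hZ.first P K Q hPQ a ha ((inl_mem_merge ?_).1 h'), ?_⟩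
            · exact fun D hD => hle D (by simp [hPQ, hD])
            · rintro ⟨b, hb, hba⟩
              obtain rfl := Sum.inl.inj hba
              exact not_mem_both_tags hnd ha hb)
          have h : ([Sum.inl a, copySym K c, Sum.inl a] ++ [copySym K c]).Sublist _ :=
            List.Sublist.trans (by simp [copySym]) h
          have h := sublist_of_append_sublist_append h hn.2
          exact haa K a hK (List.Sublist.trans (by simp [List.sublist_cons_iff]) h)
        · have h : (copySym K c :: [Sum.inl a, copySym K c, Sum.inl a]).Sublist _ :=
            (List.sublist_cons_self _ _).trans h
          have h := sublist_of_cons_sublist_append h hn.1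
          have h := sublist_of_append_sublist_append
            (l := [copySym K c, Sum.inl a, copySym K c]) h (by
            simp only [List.mem_append, List.mem_map, List.mem_reverse, mem_tagged, not_or]
            refine ⟨?_, fun h' => hZ.last P K Q hPQ a ha ((inl_mem_merge ?_).1 h')⟩
            · rintro ⟨b, hb, hba⟩
              obtain rfl := Sum.inl.inj hba
              exact not_mem_both_tags hnd hb ha
            · exact fun D hD => hle D (by simp [hPQ, hD]))
          exact haa K a hK (List.Sublist.trans (by simp [List.sublist_cons_iff]) h)
      · cases hc'
  · have hK := (copySym_mem_merge (K := K) (c := c) (h.subset (by simp [copySym]))).1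
    rcases hmix K c y (Ne.symm hxy) (List.Sublist.trans (by simp [copySym]) h) with
      ⟨a, rfl, ha⟩ | ⟨c', rfl⟩
    · have h := hZ.sublist_insertTags hne (K := K) (c := c)
        (l := [Sum.inl a, Sum.inr (K, c), Sum.inl a]) h
      exact haa K a hK (List.Sublist.trans (by simp [List.sublist_cons_iff]) h)
    · exact hcopy K c c' (fun hc => hxy (by rw [hc]; rfl)) h

/-! ### Persistence of the other conditions under merging. -/

theorem nodup_addTag {K : List (α × Bool)} {d : α × Bool} {E : List (β × Bool)}
    (hE : (E.map Prod.fst).Nodup) :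
    ((addTag d (E.map (copyTag K))).map Prod.fst).Nodup := by
  have h1 : ((E.map Prod.fst).map (copySym K)).Nodup :=
    hE.map (f := copySym K) (fun a b h => by simpa [copySym] using h)
  obtain ⟨a, _ | _⟩ := d
  · rw [addTag, List.map_cons, map_fst_copyTag, List.nodup_cons]
    exact ⟨by simp [copySym], h1⟩
  · rw [addTag, List.map_append, map_fst_copyTag, List.nodup_append]
    exact ⟨h1, by simp, by simp [copySym]⟩

theorem nodup_of_mem_insertTags {K D : List (α × Bool)} {Z : List (Block β)}
    (hZ : ∀ B ∈ Z, B.syms.Nodup) :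
    ∀ B ∈ insertTags K D Z, B.syms.Nodup := by
  have hinj : Function.Injective (copySym K : β → MergeSym α β) :=
    fun a b h => by simpa [copySym] using h
  induction Z generalizing D with
  | nil => simp [insertTags]
  | cons B Z ih =>
    have hB := hZ B (by simp)
    have ih := fun D => ih (D := D) fun B hB => hZ B (by simp [hB])
    intro C hC
    cases B with
    | reg l =>
      rw [insertTags, List.mem_cons] at hC
      rcases hC with rfl | hC
      · exact hB.map hinj
      · exact ih D C hC
    | spec E =>
      cases D with
      | nil =>
        rw [insertTags, List.mem_cons] at hC
        rcases hC with rfl | hC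
        · rw [syms, map_fst_copyTag]
          exact hB.map hinj
        · exact ih [] C hC
      | cons d D =>
        rw [insertTags, List.mem_cons] at hC
        rcases hC with rfl | hC
        · exact nodup_addTag hB
        · exact ih D C hC

theorem nodup_tagged {t : Bool} {D : List (α × Bool)} (hD : (D.map Prod.fst).Nodup) :
    (tagged t D).Nodup :=
  hD.sublist (List.filter_sublist.map _)

theorem nodup_of_mem_merge {Z : List (Block α)} {Z' : List (Block β)}
    (hZ : ∀ B ∈ Z, B.syms.Nodup) (hZ' : ∀ B ∈ Z', B.syms.Nodup) :
    ∀ B ∈ merge Z Z', B.syms.Nodup := by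
  intro C hC
  obtain ⟨B, hB, hC⟩ := List.mem_flatMap.1 hC
  have hnd := hZ B hB
  cases B with
  | reg l =>
    obtain rfl := List.mem_singleton.1 hC
    exact hnd.map Sum.inl_injective
  | spec D =>
    simp only [mergeBlock, List.mem_cons, List.mem_append, List.not_mem_nil, or_false] at hC
    rcases hC with rfl | hC | rfl
    · exact (List.nodup_reverse.2 (nodup_tagged hnd)).map Sum.inl_injective
    · exact nodup_of_mem_insertTags hZ' C hC
    · exact (List.nodup_reverse.2 (nodup_tagged hnd)).map Sum.inl_injective

/-- The decomposition of the merged sequence at a special block. -/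
theorem merge_split {Z : List (Block α)} {Z' : List (Block β)}
    (hlen : ∀ D, spec D ∈ Z → D.length = numSpec Z')
    {p q : List (Block (MergeSym α β))} {E : List (MergeSym α β × Bool)}
    (h : merge Z Z' = p ++ spec E :: q) :
    ∃ P K Q P' E' Q' D1 d D2, Z = P ++ spec K :: Q ∧ Z' = P' ++ spec E' :: Q' ∧
      K = D1 ++ d :: D2 ∧ D1.length = numSpec P' ∧ D2.length = numSpec Q' ∧
      E = addTag d (E'.map (copyTag K)) ∧
      flat p = (flat (merge P Z') ++ (tagged false K).reverse.map Sum.inl) ++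
        flat (insertTags K D1 P') ∧
      flat q = flat (insertTags K D2 Q') ++
        ((tagged true K).reverse.map Sum.inl ++ flat (merge Q Z')) := by
  obtain ⟨P, K, Q, p', q', hZ, h1, rfl, rfl⟩ := merge_eq_append h
  obtain ⟨P', E', Q', D1, d, D2, hZ', hK, h2, h3, rfl, rfl, rfl⟩ :=
    insertTags_eq_append (hlen K (by simp [hZ])) h1
  refine ⟨P, K, Q, P', E', Q', D1, d, D2, hZ, hZ', hK, h2, h3, rfl, ?_, ?_⟩
  · rw [flat_append, flat_cons, syms, List.append_assoc]
  · rw [flat_append, flat_cons, syms]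

theorem copySym_mem_insertTags {K D : List (α × Bool)} {Z : List (Block β)} {c : β} :
    copySym K c ∈ flat (insertTags K D Z) ↔ c ∈ flat Z := by
  rw [← mem_filterMap_inner, inner_insertTags]

theorem inl_mem_insertTags {K D : List (α × Bool)} {Z : List (Block β)} {a : α}
    (h : D.length ≤ numSpec Z) :
    Sum.inl a ∈ flat (insertTags K D Z) ↔ a ∈ D.map Prod.fst := by
  rw [← mem_filterMap_outer, outer_insertTags _ _ _ h]

theorem mem_addTag_copy {K : List (α × Bool)} {d : α × Bool} {E : List (β × Bool)}
    {x : MergeSym α β} {t : Bool} : (x, t) ∈ addTag d (E.map (copyTag K)) ↔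
      (x = Sum.inl d.1 ∧ t = d.2) ∨ ∃ c, x = copySym K c ∧ (c, t) ∈ E := by
  rw [mem_addTag, List.mem_map, Prod.mk.injEq]
  refine or_congr Iff.rfl ⟨?_, ?_⟩
  · rintro ⟨⟨c, s⟩, hc, h⟩
    simp only [copyTag, Prod.mk.injEq] at h
    obtain ⟨rfl, rfl⟩ := h
    exact ⟨c, rfl, hc⟩
  · rintro ⟨c, rfl, hc⟩
    exact ⟨(c, t), hc, rfl⟩

theorem inner_map_pair {K : List (α × Bool)} {c c' : β} {s t : Bool} {d : α × Bool}
    {E : List (β × Bool)}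
    (h : [(copySym K c, s), (copySym K c', t)].Sublist (addTag d (E.map (copyTag K)))) :
    [(c, s), (c', t)].Sublist E := by
  have h1 : ((addTag d (E.map (copyTag K))).filterMap
      fun x => (inner K x.1).map fun y => (y, x.2)) = E := by
    have h2 : ((fun x : MergeSym α β × Bool => (inner K x.1).map fun y => (y, x.2)) ∘ copyTag K) =
        some := by
      funext x
      simp [copyTag, inner_some]
    obtain ⟨a, _ | _⟩ := d <;>
      simp only [addTag, List.filterMap_cons, List.filterMap_append, List.filterMap_map, h2,
        List.filterMap_some] <;> simp [inner]
  have h3 := h.filterMap fun x => (inner K x.1).map fun y => (y, x.2)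
  rw [h1] at h3
  simpa [inner_some] using h3

theorem notMem_of_nodup_append_cons {D1 D2 : List (α × Bool)} {d : α × Bool}
    (h : ((D1 ++ d :: D2).map Prod.fst).Nodup) :
    d.1 ∉ D1.map Prod.fst ∧ d.1 ∉ D2.map Prod.fst := by
  rw [List.map_append, List.map_cons, List.nodup_append, List.nodup_cons] at h
  exact ⟨fun h1 => h.2.2 _ h1 _ (by simp) rfl, h.2.1.1⟩

/-- The placement in `addTag` is what preserves the order conditions: after a copy only its outer
symbols can return, so a new first occurrence must be the later member of any pair of first
occurrences, and dually for last ones. -/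
theorem Good.merge {Z : List (Block α)} {Z' : List (Block β)} (hZ : Good Z) (hZ' : Good Z')
    (hlen : ∀ D, spec D ∈ Z → D.length = numSpec Z') (hpos : 0 < numSpec Z') :
    Good (merge Z Z') := by
  have hle : ∀ D, spec D ∈ Z → D.length ≤ numSpec Z' := fun D hD => (hlen D hD).le
  have hne : ∀ D, spec D ∈ Z → D ≠ [] := fun D hD =>
    List.ne_nil_of_length_pos ((hlen D hD).symm ▸ hpos)
  have hcross : ∀ (K : List (α × Bool)) (D : List (α × Bool)) (a : α)
      (V : List (Block β)), D.length ≤ numSpec V →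
      a ∉ D.map Prod.fst → Sum.inl a ∉ flat (insertTags K D V) :=
    fun K D a V h1 h2 h3 => h2 ((inl_mem_insertTags h1).1 h3)
  refine ⟨nodup_of_mem_merge hZ.nodup hZ'.nodup, ?_, ?_, ?_, ?_, ?_, hZ.avoid_merge hZ' hlen hpos⟩
  · intro p E q h x hx
    obtain ⟨P, K, Q, P', E', Q', D1, d, D2, hPQ, hPQ', hK, h1, h2, rfl, hp, hq⟩ :=
      merge_split hlen h
    have hnd := hZ.nodup (spec K) (by simp [hPQ])
    rw [hp, List.mem_append, not_or]
    rcases mem_addTag_copy.1 hx with ⟨rfl, ht⟩ | ⟨c, rfl, hc⟩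
    · have hd : (d.1, true) ∈ K := by rw [ht, hK]; simp
      have hd1 := notMem_of_nodup_append_cons (hK ▸ hnd)
      constructor
      · rw [List.mem_append, not_or]
        constructor
        · rw [inl_mem_merge fun D hD => hle D (by simp [hPQ, hD])]
          exact hZ.first P K Q hPQ d.1 hd
        · simp only [List.mem_map, List.mem_reverse, mem_tagged, Sum.inl.injEq, exists_eq_right]
          exact not_mem_both_tags hnd hd
      · rw [inl_mem_insertTags h1.le]
        exact hd1.1
    · refine ⟨(hZ.copySym_notMem hPQ (hne K (by simp [hPQ])) c).1, ?_⟩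
      rw [copySym_mem_insertTags]
      exact hZ'.first P' E' Q' hPQ' c hc
  · intro p E q h x hx
    obtain ⟨P, K, Q, P', E', Q', D1, d, D2, hPQ, hPQ', hK, h1, h2, rfl, hp, hq⟩ :=
      merge_split hlen h
    have hnd := hZ.nodup (spec K) (by simp [hPQ])
    rw [hq, List.mem_append, not_or]
    rcases mem_addTag_copy.1 hx with ⟨rfl, ht⟩ | ⟨c, rfl, hc⟩
    · have hd : (d.1, false) ∈ K := by rw [ht, hK]; simp
      have hd1 := notMem_of_nodup_append_cons (hK ▸ hnd)
      constructor
      · rw [inl_mem_insertTags h2.le]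
        exact hd1.2
      · rw [List.mem_append, not_or]
        constructor
        · simp only [List.mem_map, List.mem_reverse, mem_tagged, Sum.inl.injEq, exists_eq_right]
          exact fun h => not_mem_both_tags hnd h hd
        · rw [inl_mem_merge fun D hD => hle D (by simp [hPQ, hD])]
          exact hZ.last P K Q hPQ d.1 hd
    · refine ⟨?_, (hZ.copySym_notMem hPQ (hne K (by simp [hPQ])) c).2⟩
      rw [copySym_mem_insertTags]
      exact hZ'.last P' E' Q' hPQ' c hc
  · intro p E q h x y hxy hyx
    obtain ⟨P, K, Q, P', E', Q', D1, d, D2, hPQ, hPQ', hK, h1, h2, rfl, hp, hq⟩ :=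
      merge_split hlen h
    have hnd := hZ.nodup (spec K) (by simp [hPQ])
    have hd1 := notMem_of_nodup_append_cons (hK ▸ hnd)
    rw [hq] at hyx
    rcases mem_addTag_copy.1 (hxy.subset (List.mem_cons_self)) with ⟨rfl, ht⟩ | ⟨c, rfl, hc⟩
    -- Impossible case: a first occurrence from outside stands at the end of its block, so nothing
    -- follows it.
    · obtain ⟨d, t⟩ := d
      obtain rfl : true = t := ht
      have h3 := hxy.reverse
      simp only [addTag, List.reverse_append, List.reverse_cons, List.reverse_nil, List.nil_append,
        List.singleton_append] at h3
      have hy : (y, true) ∈ addTag (d, true) (E'.map (copyTag K)) := hxy.subset (by simp)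
      have hnd' := nodup_addTag (K := K) (d := (d, true)) (hZ'.nodup (spec E') (by simp [hPQ']))
      have h4 := (hxy.map Prod.fst).nodup hnd'
      simp only [List.map_cons, List.map_nil, List.nodup_cons, List.mem_singleton] at h4
      have h5 : ([(Sum.inl d, true)] : List (MergeSym α β × Bool)).Sublist
          (E'.map (copyTag K)).reverse := by
        rw [List.sublist_cons_iff] at h3
        rcases h3 with h3 | ⟨r, hr, _⟩
        · exact (List.sublist_cons_self _ _).trans h3
        · exact absurd (congrArg Prod.fst (List.cons.inj hr).1).symm h4.1
      have h6 : (Sum.inl d, true) ∈ (E'.map (copyTag K)).reverse := h5.subset (by simp)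
      simp [copyTag, copySym] at h6
    -- The copy symbol `c` is absent after its copy, so the reversed pair lies in the rest of the
    -- copy, where an outer `y` does not recur.
    · rw [← List.singleton_append] at hyx
      have h3 := sublist_of_append_sublist_append hyx
        (hZ.copySym_notMem hPQ (hne K (by simp [hPQ])) c).2
      rcases mem_addTag_copy.1 (hxy.subset (List.mem_cons_of_mem _ List.mem_cons_self)) with
        ⟨rfl, ht⟩ | ⟨c', rfl, hc'⟩
      · exact hcross K D2 d.1 Q' h2.le hd1.2 (h3.subset (by simp))
      · have h3 := h3.filterMap (inner K)
        rw [inner_insertTags] at h3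
        simp only [List.singleton_append, List.filterMap_cons, inner_some,
          List.filterMap_nil] at h3
        exact hZ'.first_pair P' E' Q' hPQ' c c' (inner_map_pair hxy) h3
  · intro p E q h x y hxy hyx
    obtain ⟨P, K, Q, P', E', Q', D1, d, D2, hPQ, hPQ', hK, h1, h2, rfl, hp, hq⟩ :=
      merge_split hlen h
    have hnd := hZ.nodup (spec K) (by simp [hPQ])
    have hd1 := notMem_of_nodup_append_cons (hK ▸ hnd)
    rw [hp] at hyx
    rcases mem_addTag_copy.1 (hxy.subset (List.mem_cons_of_mem _ List.mem_cons_self)) with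
      ⟨rfl, ht⟩ | ⟨c, rfl, hc⟩
    · obtain ⟨d, t⟩ := d
      obtain rfl : false = t := ht
      have hnd' := nodup_addTag (K := K) (d := (d, false)) (hZ'.nodup (spec E') (by simp [hPQ']))
      have h4 := (hxy.map Prod.fst).nodup hnd'
      simp only [List.map_cons, List.map_nil, List.nodup_cons, List.mem_singleton] at h4
      have h5 : ([(Sum.inl d, false)] : List (MergeSym α β × Bool)).Sublist
          (E'.map (copyTag K)) := by
        rw [addTag, List.sublist_cons_iff] at hxy
        rcases hxy with h3 | ⟨r, hr, _⟩
        · exact (List.sublist_cons_self _ _).trans h3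
        · exact absurd (congrArg Prod.fst (List.cons.inj hr).1) h4.1
      have h6 : (Sum.inl d, false) ∈ E'.map (copyTag K) := h5.subset (by simp)
      simp [copyTag, copySym] at h6
    · have h3 := sublist_of_cons_sublist_append hyx
        (hZ.copySym_notMem hPQ (hne K (by simp [hPQ])) c).1
      rcases mem_addTag_copy.1 (hxy.subset List.mem_cons_self) with ⟨rfl, ht⟩ | ⟨c', rfl, hc'⟩
      · exact hcross K D1 d.1 P' h1.le hd1.1 (h3.subset (by simp))
      · have h3 := h3.filterMap (inner K)
        rw [inner_insertTags] at h3
        simp only [List.filterMap_cons, inner_some, List.filterMap_nil] at h3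
        exact hZ'.last_pair P' E' Q' hPQ' c' c (inner_map_pair hxy) h3
  · intro E F x y hE hF hxy hx1 hy1 hx2 hy2
    obtain ⟨p, q, h⟩ := List.append_of_mem hE
    obtain ⟨r, s, h'⟩ := List.append_of_mem hF
    obtain ⟨P, K, Q, P', E', Q', D1, d, D2, hPQ, hPQ', hK, h1, h2, rfl, hp, hq⟩ :=
      merge_split hlen h
    obtain ⟨R, K', S, R', F', S', G1, e, G2, hRS, hRS', hK', h3, h4, rfl, hr, hs⟩ :=
      merge_split hlen h'
    have hnd := hZ.nodup (spec K) (by simp [hPQ])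
    -- If a copy symbol and an outer one shared two special blocks, these would lie in one copy, and
    -- the outer symbol would carry both tags in `K`.
    have houter : K' = K → d.1 = e.1 → d.2 = true → e.2 = false → False := by
      intro hKK hde hd he
      refine not_mem_both_tags hnd (a := d.1) ?_ ?_
      · rw [← hd, hK]; simp
      · rw [← hKK, hde, ← he, hK']; simp
    rcases mem_addTag_copy.1 hx1 with ⟨rfl, hd⟩ | ⟨c, rfl, hc⟩
    · rcases mem_addTag_copy.1 hy1 with ⟨rfl, _⟩ | ⟨c', rfl, hc'⟩
      · exact hxy rfl
      · rcases mem_addTag_copy.1 hx2 with ⟨hde, he⟩ | ⟨c, h0, _⟩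
        · rcases mem_addTag_copy.1 hy2 with ⟨h0, _⟩ | ⟨c'', h0, _⟩
          · cases h0
          · simp only [copySym, Sum.inr.injEq, Prod.mk.injEq] at h0
            exact houter h0.1.symm (Sum.inl.inj hde) hd.symm he.symm
        · cases h0
    · rcases mem_addTag_copy.1 hx2 with ⟨h0, _⟩ | ⟨c2, h0, hc2⟩
      · cases h0
      · simp only [copySym, Sum.inr.injEq, Prod.mk.injEq] at h0
        obtain ⟨rfl, rfl⟩ := h0
        rcases mem_addTag_copy.1 hy1 with ⟨rfl, hd⟩ | ⟨c', rfl, hc'⟩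
        · rcases mem_addTag_copy.1 hy2 with ⟨hde, he⟩ | ⟨c'', h0, _⟩
          · exact houter rfl (Sum.inl.inj hde) hd.symm he.symm
          · cases h0
        · rcases mem_addTag_copy.1 hy2 with ⟨h0, _⟩ | ⟨c'', h0, hc''⟩
          · cases h0
          · simp only [copySym, Sum.inr.injEq, Prod.mk.injEq, true_and] at h0
            subst h0
            exact hZ'.share E' F' c c' (by simp [hPQ']) (by simp [hRS'])
              (fun h => hxy (by rw [h])) hc hc' hc2 hc''

/-! ### Counting blocks and occurrences. -/

theorem numSpec_insertTags (K D : List (α × Bool)) (Z : List (Block β)) :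
    numSpec (insertTags K D Z) = numSpec Z := by
  induction Z generalizing D with
  | nil => rfl
  | cons B Z ih => cases B <;> cases D <;> simp [insertTags, numSpec, ih]

theorem length_insertTags (K D : List (α × Bool)) (Z : List (Block β)) :
    (insertTags K D Z).length = Z.length := by
  induction Z generalizing D with
  | nil => rfl
  | cons B Z ih => cases B <;> cases D <;> simp [insertTags, ih]

theorem length_addTag (d : α × Bool) (E : List (MergeSym α β × Bool)) :
    (addTag d E).length = E.length + 1 := by
  obtain ⟨a, _ | _⟩ := d <;> simp [addTag]

theorem length_flat_insertTags (K D : List (α × Bool)) (Z : List (Block β))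
    (h : D.length ≤ numSpec Z) :
    (flat (insertTags K D Z)).length = D.length + (flat Z).length := by
  induction Z generalizing D with
  | nil =>
    obtain rfl : D = [] := by simpa [numSpec] using h
    rfl
  | cons B Z ih =>
    cases B with
    | reg l =>
      rw [insertTags, flat_cons, flat_cons, List.length_append, ih D h]
      simp [syms]
      omega
    | spec E =>
      cases D with
      | nil =>
        rw [insertTags, flat_cons, flat_cons, List.length_append, ih [] (by simp)]
        simp [syms]
      | cons d D =>
        rw [insertTags, flat_cons, flat_cons, List.length_append, ih D (by simpa [numSpec] using h)]
        simp [syms, length_addTag]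
        omega

theorem length_tagged (D : List (α × Bool)) :
    (tagged false D).length + (tagged true D).length = D.length := by
  induction D with
  | nil => rfl
  | cons d D ih =>
    obtain ⟨a, _ | _⟩ := d <;> simp [tagged] at ih ⊢ <;> omega

theorem numSpec_merge (Z : List (Block α)) (Z' : List (Block β)) :
    numSpec (merge Z Z') = numSpec Z * numSpec Z' := by
  induction Z with
  | nil => simp [merge, numSpec]
  | cons B Z ih =>
    rw [merge_cons, numSpec_append, ih]
    cases B with
    | reg l => simp [mergeBlock, numSpec]
    | spec D =>
      simp only [mergeBlock, numSpec, numSpec_append, numSpec_insertTags]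
      ring

theorem length_merge (Z : List (Block α)) (Z' : List (Block β)) :
    (merge Z Z').length = Z.length + numSpec Z * (Z'.length + 1) := by
  induction Z with
  | nil => simp [merge, numSpec]
  | cons B Z ih =>
    rw [merge_cons, List.length_append, ih]
    cases B with
    | reg l => simp [mergeBlock, numSpec]; omega
    | spec D =>
      simp only [mergeBlock, numSpec, List.length_cons, List.length_append, length_insertTags,
        List.length_nil]
      ring

theorem length_flat_merge (Z : List (Block α)) (Z' : List (Block β))
    (h : ∀ D, spec D ∈ Z → D.length = numSpec Z') :
    (flat (merge Z Z')).length =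
      (flat Z).length + numSpec Z * (numSpec Z' + (flat Z').length) := by
  induction Z with
  | nil => simp [merge, numSpec, flat]
  | cons B Z ih =>
    rw [merge_cons, flat_append, List.length_append, ih fun D hD => h D (by simp [hD]), flat_cons]
    cases B with
    | reg l => simp [mergeBlock, numSpec, flat, syms]; omega
    | spec D =>
      have hD := h D (by simp)
      have hD' := length_tagged D
      simp only [mergeBlock, flat_cons, flat_append, flat_nil, List.length_append, syms,
        List.length_map, List.length_reverse, length_flat_insertTags D D Z' hD.le, numSpec,
        List.length_nil]
      rw [add_mul, one_mul]
      omega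

theorem exists_list_spec (Z : List (Block α)) :
    ∃ L : List (List (α × Bool)), L.length = numSpec Z ∧ ∀ D, spec D ∈ Z → D ∈ L := by
  induction Z with
  | nil => exact ⟨[], rfl, by simp⟩
  | cons B Z ih =>
    obtain ⟨L, hL, hm⟩ := ih
    cases B with
    | reg l => exact ⟨L, hL, by simpa using hm⟩
    | spec D =>
      refine ⟨D :: L, by simp [numSpec, hL], ?_⟩
      simp only [List.mem_cons, spec.injEq]
      exact fun E hE => hE.imp_right (hm E)

end

/-! ### Realizable parameters and their merging. -/

/-- There is a sequence of blocks as in the construction, with `S` special blocks, all of length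
`m`, in which each of the `N = m * S / 2` symbols occurs on average `2 * d` times. -/
def Realizable (d m S : ℕ) : Prop :=
  ∃ (α : Type) (_ : Countable α) (Z : List (Block α)) (l : List α), Good Z ∧ numSpec Z = S ∧
    (∀ D, spec D ∈ Z → D.length = m) ∧ 2 * l.length = m * S ∧
    (flat Z).length = 2 * d * l.length ∧ flat Z ⊆ l ∧ Z.length + 4 ≤ 2 * S

theorem Realizable.merge {d m f g : ℕ} (h : Realizable d f g) (h' : Realizable (d + 1) m f)
    (hf : 0 < f) : Realizable (d + 1) (m + 1) (f * g) := by
  obtain ⟨α, _, Z, l, hZ, rfl, hlen, hl, hflat, hsub, hcard⟩ := h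
  obtain ⟨β, _, Z', l', hZ', rfl, hlen', hl', hflat', hsub', hcard'⟩ := h'
  obtain ⟨L, hL, hLm⟩ := exists_list_spec Z
  have hsize : (l.map Sum.inl ++ L.flatMap fun K => l'.map (copySym K)).length =
      l.length + numSpec Z * l'.length := by
    simp [List.length_flatMap, hL]
  refine ⟨MergeSym α β, inferInstance, Block.merge Z Z',
    l.map Sum.inl ++ L.flatMap fun K => l'.map (copySym K), hZ.merge hZ' hlen hf, ?_, ?_, ?_, ?_,
    ?_, ?_⟩
  · rw [numSpec_merge, mul_comm]
  · intro E hE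
    obtain ⟨p, q, h⟩ := List.append_of_mem hE
    obtain ⟨P, K, Q, P', E', Q', D1, d, D2, hPQ, hPQ', hK, h1, h2, rfl, hp, hq⟩ :=
      merge_split hlen h
    rw [length_addTag, List.length_map, hlen' E' (by simp [hPQ'])]
  · rw [hsize]
    linear_combination hl + numSpec Z * hl'
  · rw [length_flat_merge Z Z' hlen, hsize, hflat, hflat']
    -- The repetitions number `numSpec Z * numSpec Z'`, which is `2 * l.length`: two further
    -- occurrences per outer symbol.
    linear_combination - hl
  · rintro (a | ⟨K, c⟩) hx
    · rw [inl_mem_merge fun D hD => (hlen D hD).le] at hx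
      simp [hsub hx]
    · have := copySym_mem_merge hx
      refine List.mem_append_right _ (List.mem_flatMap.2 ⟨K, hLm K this.1, ?_⟩)
      exact List.mem_map_of_mem (hsub' this.2)
  · rw [length_merge]
    have : 1 ≤ numSpec Z := by omega
    -- With `f` inner and `g` outer special blocks, the merge has at most `(2 * g - 4) + g * (2 * f
    -- - 3)` blocks. The slack 4 thus survives.
    nlinarith

/-- With no symbols every `d` is allowed. Four empty blocks are the fewest that satisfy the bound on
the number of blocks. -/
theorem realizable_zero (d : ℕ) : Realizable d 0 4 := by
  have hflat : flat (List.replicate 4 (spec ([] : List (ℕ × Bool)))) = [] := rfl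
  have hD : ∀ P D Q, List.replicate 4 (spec ([] : List (ℕ × Bool))) = P ++ spec D :: Q →
      D = [] := by
    intro P D Q h
    have : spec D ∈ List.replicate 4 (spec ([] : List (ℕ × Bool))) := by simp [h]
    simpa using List.eq_of_mem_replicate this
  refine ⟨ℕ, inferInstance, List.replicate 4 (spec []), [],
    ⟨?_, ?_, ?_, ?_, ?_, ?_, ?_⟩, rfl, ?_, rfl, ?_, ?_, by simp⟩
  · intro B hB
    rw [List.eq_of_mem_replicate hB]
    exact List.nodup_nil
  · intro P D Q h a ha
    simp [hD P D Q h] at ha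
  · intro P D Q h a ha
    simp [hD P D Q h] at ha
  · intro P D Q h a b hab
    simp [hD P D Q h] at hab
  · intro P D Q h a b hab
    simp [hD P D Q h] at hab
  · intro D E a b h _ _ ha
    obtain ⟨P, Q, h⟩ := List.append_of_mem h
    simp [hD P D Q h] at ha
  · intro a b _
    rw [hflat]
    simp
  · intro D hD
    have := List.eq_of_mem_replicate hD
    simp at this
    simp [this]
  · rw [hflat]
    simp
  · rw [hflat]
    simp

/-! ### The base case `d = 1`: a grid. -/

/-- The `i`-th row of a grid, as a special block of first occurrences. -/
def gridRow (m i : ℕ) : Block (ℕ × ℕ) := spec ((List.range m).map fun j => ((i, j), true))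

/-- The `j`-th column of a grid, as a special block of last occurrences. -/
def gridCol (m j : ℕ) : Block (ℕ × ℕ) := spec ((List.range m).map fun i => ((i, j), false))

theorem syms_gridRow (m i : ℕ) : (gridRow m i).syms = (List.range m).map fun j => (i, j) := by
  simp [gridRow, syms]

theorem syms_gridCol (m j : ℕ) : (gridCol m j).syms = (List.range m).map fun i => (i, j) := by
  simp [gridCol, syms]

theorem flat_map_gridRow (m : ℕ) (l : List ℕ) :
    flat (l.map (gridRow m)) = l.flatMap fun i => (List.range m).map fun j => (i, j) := by
  simp [flat, List.flatMap_map, syms_gridRow]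

theorem flat_map_gridCol (m : ℕ) (l : List ℕ) :
    flat (l.map (gridCol m)) = l.flatMap fun j => (List.range m).map fun i => (i, j) := by
  simp [flat, List.flatMap_map, syms_gridCol]

theorem mem_flat_gridRow {m : ℕ} {l : List ℕ} {a : ℕ × ℕ} :
    a ∈ flat (l.map (gridRow m)) ↔ a.1 ∈ l ∧ a.2 < m := by
  obtain ⟨i, j⟩ := a
  rw [flat_map_gridRow]
  simp only [List.mem_flatMap, List.mem_map, List.mem_range, Prod.mk.injEq]
  constructor
  · rintro ⟨i, hi, j, hj, rfl, rfl⟩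
    exact ⟨hi, hj⟩
  · rintro ⟨hi, hj⟩
    exact ⟨i, hi, j, hj, rfl, rfl⟩

theorem mem_flat_gridCol {m : ℕ} {l : List ℕ} {a : ℕ × ℕ} :
    a ∈ flat (l.map (gridCol m)) ↔ a.2 ∈ l ∧ a.1 < m := by
  obtain ⟨i, j⟩ := a
  rw [flat_map_gridCol]
  simp only [List.mem_flatMap, List.mem_map, List.mem_range, Prod.mk.injEq]
  constructor
  · rintro ⟨j, hj, i, hi, rfl, rfl⟩
    exact ⟨hj, hi⟩
  · rintro ⟨hj, hi⟩
    exact ⟨j, hj, i, hi, rfl, rfl⟩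

/-- The rows of a grid followed by its columns. -/
def grid (m : ℕ) : List (Block (ℕ × ℕ)) :=
  (List.range m).map (gridRow m) ++ (List.range m).map (gridCol m)

theorem pairwise_flat_gridRow (m : ℕ) :
    (flat ((List.range m).map (gridRow m))).Pairwise fun x y => x.1 ≤ y.1 := by
  rw [flat_map_gridRow, List.pairwise_flatMap]
  constructor
  · intro i _
    rw [List.pairwise_map]
    exact List.pairwise_of_forall fun _ _ => le_rfl
  · refine List.pairwise_lt_range.imp fun {i j} hij => ?_
    simp only [List.mem_map, forall_exists_index, and_imp, forall_apply_eq_imp_iff₂]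
    exact fun _ _ _ _ => hij.le

theorem pairwise_flat_gridCol (m : ℕ) :
    (flat ((List.range m).map (gridCol m))).Pairwise fun x y => x.2 ≤ y.2 := by
  rw [flat_map_gridCol, List.pairwise_flatMap]
  constructor
  · intro i _
    rw [List.pairwise_map]
    exact List.pairwise_of_forall fun _ _ => le_rfl
  · refine List.pairwise_lt_range.imp fun {i j} hij => ?_
    simp only [List.mem_map, forall_exists_index, and_imp, forall_apply_eq_imp_iff₂]
    exact fun _ _ _ _ => hij.le

theorem nodup_flat_gridRow (m : ℕ) : (flat ((List.range m).map (gridRow m))).Nodup := by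
  rw [flat_map_gridRow]
  exact List.nodup_range.product List.nodup_range

theorem nodup_flat_gridCol (m : ℕ) : (flat ((List.range m).map (gridCol m))).Nodup := by
  have h : flat ((List.range m).map (gridCol m)) =
      (flat ((List.range m).map (gridRow m))).map Prod.swap := by
    rw [flat_map_gridCol, flat_map_gridRow, List.map_flatMap]
    simp [Function.comp_def]
  rw [h]
  exact (nodup_flat_gridRow m).map Prod.swap_injective

theorem grid_eq_append {m : ℕ} {P Q : List (Block (ℕ × ℕ))} {D : List ((ℕ × ℕ) × Bool)}
    (h : grid m = P ++ spec D :: Q) :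
    (∃ i l1 l2, List.range m = l1 ++ i :: l2 ∧ P = l1.map (gridRow m) ∧ spec D = gridRow m i ∧
      Q = l2.map (gridRow m) ++ (List.range m).map (gridCol m)) ∨
    (∃ j l1 l2, List.range m = l1 ++ j :: l2 ∧
      P = (List.range m).map (gridRow m) ++ l1.map (gridCol m) ∧ spec D = gridCol m j ∧
      Q = l2.map (gridCol m)) := by
  rw [grid, List.append_eq_append_iff] at h
  have hcol : ∀ P', (List.range m).map (gridCol m) = P' ++ spec D :: Q →
      P = (List.range m).map (gridRow m) ++ P' → ∃ j l1 l2, List.range m = l1 ++ j :: l2 ∧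
      P = (List.range m).map (gridRow m) ++ l1.map (gridCol m) ∧ spec D = gridCol m j ∧
      Q = l2.map (gridCol m) := by
    intro P' h hP
    obtain ⟨l1, l2, h1, rfl, h2⟩ := List.map_eq_append_iff.1 h
    obtain ⟨j, l2, rfl, h3, rfl⟩ := List.map_eq_cons_iff.1 h2
    exact ⟨j, l1, l2, h1, hP, h3.symm, rfl⟩
  rcases h with ⟨P', hP, h⟩ | ⟨Q', h, hQ⟩
  · exact Or.inr (hcol P' h hP)
  · rw [List.cons_eq_append_iff] at hQ
    rcases hQ with ⟨rfl, hQ⟩ | ⟨Q'', rfl, hQ⟩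
    · exact Or.inr (hcol [] hQ (by simpa using h.symm))
    · obtain ⟨l1, l2, h1, rfl, h2⟩ := List.map_eq_append_iff.1 h
      obtain ⟨j, l2, rfl, h3, rfl⟩ := List.map_eq_cons_iff.1 h2
      exact Or.inl ⟨j, l1, l2, h1, rfl, h3.symm, hQ⟩

theorem notMem_of_range_eq {m i : ℕ} {l1 l2 : List ℕ} (h : List.range m = l1 ++ i :: l2) :
    i ∉ l1 ∧ i ∉ l2 := by
  have h1 : (l1 ++ i :: l2).Nodup := h ▸ List.nodup_range
  rw [List.nodup_append, List.nodup_cons] at h1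
  exact ⟨fun h => h1.2.2 i h i (by simp) rfl, h1.2.1.1⟩

theorem mem_gridRow {m i : ℕ} {D : List ((ℕ × ℕ) × Bool)} (h : spec D = gridRow m i)
    {a : ℕ × ℕ} {t : Bool} (ha : (a, t) ∈ D) : a.1 = i ∧ t = true := by
  rw [gridRow, spec.injEq] at h
  subst h
  simp only [List.mem_map, Prod.mk.injEq] at ha
  obtain ⟨j, _, rfl, rfl⟩ := ha
  exact ⟨rfl, rfl⟩

theorem mem_gridCol {m j : ℕ} {D : List ((ℕ × ℕ) × Bool)} (h : spec D = gridCol m j)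
    {a : ℕ × ℕ} {t : Bool} (ha : (a, t) ∈ D) : a.2 = j ∧ t = false := by
  rw [gridCol, spec.injEq] at h
  subst h
  simp only [List.mem_map, Prod.mk.injEq] at ha
  obtain ⟨i, _, rfl, rfl⟩ := ha
  exact ⟨rfl, rfl⟩

theorem lt_of_sublist_gridRow {m i : ℕ} {D : List ((ℕ × ℕ) × Bool)} (h : spec D = gridRow m i)
    {a b : ℕ × ℕ} {s t : Bool} (hab : [(a, s), (b, t)].Sublist D) : a.2 < b.2 := by
  rw [gridRow, spec.injEq] at h
  subst h
  have h1 : ((List.range m).map fun j => (((i, j), true) : (ℕ × ℕ) × Bool)).Pairwise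
      fun x y => x.1.2 < y.1.2 := by
    rw [List.pairwise_map]
    exact List.pairwise_lt_range
  simpa using h1.sublist hab

theorem lt_of_sublist_gridCol {m j : ℕ} {D : List ((ℕ × ℕ) × Bool)} (h : spec D = gridCol m j)
    {a b : ℕ × ℕ} {s t : Bool} (hab : [(a, s), (b, t)].Sublist D) : a.1 < b.1 := by
  rw [gridCol, spec.injEq] at h
  subst h
  have h1 : ((List.range m).map fun i => (((i, j), false) : (ℕ × ℕ) × Bool)).Pairwise
      fun x y => x.1.1 < y.1.1 := by
    rw [List.pairwise_map]
    exact List.pairwise_lt_range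
  simpa using h1.sublist hab

/-- A row and a column meet in a single symbol, which gives `share`. Rows list symbols in the order
in which the columns come, and conversely, which gives the order conditions. Every symbol occurs at
most twice, too few for a forbidden pattern. -/
theorem good_grid (m : ℕ) : Good (grid m) := by
  refine ⟨?_, ?_, ?_, ?_, ?_, ?_, ?_⟩
  · intro B hB
    rw [grid, List.mem_append, List.mem_map, List.mem_map] at hB
    rcases hB with ⟨i, _, rfl⟩ | ⟨j, _, rfl⟩
    · rw [syms_gridRow]
      exact List.nodup_range.map fun a b h => by simpa using h
    · rw [syms_gridCol]
      exact List.nodup_range.map fun a b h => by simpa using h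
  · intro P D Q h a ha
    rcases grid_eq_append h with ⟨i, l1, l2, hl, rfl, hD, rfl⟩ | ⟨j, l1, l2, hl, rfl, hD, rfl⟩
    · rw [mem_flat_gridRow, (mem_gridRow hD ha).1]
      exact fun h => (notMem_of_range_eq hl).1 h.1
    · simpa using (mem_gridCol hD ha).2
  · intro P D Q h a ha
    rcases grid_eq_append h with ⟨i, l1, l2, hl, rfl, hD, rfl⟩ | ⟨j, l1, l2, hl, rfl, hD, rfl⟩
    · simpa using (mem_gridRow hD ha).2
    · rw [mem_flat_gridCol, (mem_gridCol hD ha).1]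
      exact fun h => (notMem_of_range_eq hl).2 h.1
  · intro P D Q h a b hab hba
    have hb : (b, true) ∈ D := hab.subset (by simp)
    rcases grid_eq_append h with ⟨i, l1, l2, hl, rfl, hD, rfl⟩ | ⟨j, l1, l2, hl, rfl, hD, rfl⟩
    · rw [flat_append] at hba
      have h1 := sublist_of_cons_sublist_append hba (by
        rw [mem_flat_gridRow, (mem_gridRow hD hb).1]
        exact fun h => (notMem_of_range_eq hl).2 h.1)
      have h2 : b.2 ≤ a.2 := by simpa using (pairwise_flat_gridCol m).sublist h1
      exact absurd (lt_of_sublist_gridRow hD hab) (not_lt.2 h2)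
    · simpa using (mem_gridCol hD hb).2
  · intro P D Q h a b hab hba
    have ha : (a, false) ∈ D := hab.subset (by simp)
    rcases grid_eq_append h with ⟨i, l1, l2, hl, rfl, hD, rfl⟩ | ⟨j, l1, l2, hl, rfl, hD, rfl⟩
    · simpa using (mem_gridRow hD ha).2
    · rw [flat_append, ← List.singleton_append] at hba
      have h1 := sublist_of_append_sublist_append hba (by
        rw [mem_flat_gridCol, (mem_gridCol hD ha).1]
        exact fun h => (notMem_of_range_eq hl).1 h.1)
      have h2 : b.1 ≤ a.1 := by simpa using (pairwise_flat_gridRow m).sublist h1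
      exact absurd (lt_of_sublist_gridCol hD hab) (not_lt.2 h2)
  · intro D E a b hD hE hab ha hb ha' hb'
    have hrow : a.1 = b.1 := by
      obtain ⟨P, Q, h⟩ := List.append_of_mem hD
      rcases grid_eq_append h with ⟨i, l1, l2, hl, -, h, -⟩ | ⟨j, l1, l2, hl, -, h, -⟩
      · rw [(mem_gridRow h ha).1, (mem_gridRow h hb).1]
      · simpa using (mem_gridCol h ha).2
    have hcol : a.2 = b.2 := by
      obtain ⟨P, Q, h⟩ := List.append_of_mem hE
      rcases grid_eq_append h with ⟨i, l1, l2, hl, -, h, -⟩ | ⟨j, l1, l2, hl, -, h, -⟩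
      · simpa using (mem_gridRow h ha').2
      · rw [(mem_gridCol h ha').1, (mem_gridCol h hb').1]
    exact hab (Prod.ext hrow hcol)
  · intro a b hab h
    rw [grid, flat_append] at h
    have h1 := h.count_le a
    rw [List.count_append] at h1
    have h2 := List.nodup_iff_count_le_one.1 (nodup_flat_gridRow m) a
    have h3 := List.nodup_iff_count_le_one.1 (nodup_flat_gridCol m) a
    simp [hab.symm] at h1
    omega

theorem numSpec_map {γ α : Type} (f : γ → List (α × Bool)) (l : List γ) :
    numSpec (l.map fun x => spec (f x)) = l.length := by
  induction l with
  | nil => rfl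
  | cons x l ih => simp [numSpec, ih]

theorem realizable_one (m : ℕ) (hm : 2 ≤ m) : Realizable 1 m (2 * m) := by
  refine ⟨ℕ × ℕ, inferInstance, grid m, flat ((List.range m).map (gridRow m)), good_grid m,
    ?_, ?_, ?_, ?_, ?_, ?_⟩
  · rw [grid, numSpec_append]
    unfold gridRow gridCol
    rw [numSpec_map, numSpec_map, List.length_range]
    ring
  · intro D hD
    rw [grid, List.mem_append, List.mem_map, List.mem_map] at hD
    rcases hD with ⟨i, _, h⟩ | ⟨j, _, h⟩ <;> (cases h; simp)
  · rw [flat_map_gridRow]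
    simp [List.length_flatMap]
    ring
  · rw [grid, flat_append, List.length_append, flat_map_gridRow, flat_map_gridCol]
    simp [List.length_flatMap]
    ring
  · intro a ha
    rw [grid, flat_append, List.mem_append, mem_flat_gridRow, mem_flat_gridCol] at ha
    rw [mem_flat_gridRow]
    simpa [and_comm] using ha
  · simp [grid]
    omega

/-! ### The double recursion. -/

/-- The number of special blocks in the sequence constructed for the parameters `d + 1` and `m`. -/
def specCount : ℕ → ℕ → ℕ
  | 0, m => 2 * m
  | _ + 1, 0 => 4
  | d + 1, m + 1 => specCount (d + 1) m * specCount d (specCount (d + 1) m)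

theorem four_le_specCount (d m : ℕ) (h : d = 0 → 2 ≤ m) : 4 ≤ specCount d m := by
  induction d generalizing m with
  | zero => simp only [specCount]; have := h rfl; omega
  | succ d ihd =>
    induction m with
    | zero => simp [specCount]
    | succ m ihm =>
      have h1 : 4 ≤ specCount (d + 1) m := ihm (by simp)
      have h2 := ihd (specCount (d + 1) m) (fun _ => by omega)
      rw [specCount]
      nlinarith

theorem realizable_specCount (d m : ℕ) (h : d = 0 → 2 ≤ m) :
    Realizable (d + 1) m (specCount d m) := by
  induction d generalizing m with
  | zero =>
    rw [specCount]
    exact realizable_one m (h rfl)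
  | succ d ihd =>
    induction m with
    | zero =>
      rw [specCount]
      exact realizable_zero _
    | succ m ihm =>
      have h1 := four_le_specCount (d + 1) m (by simp)
      rw [specCount]
      -- The outer sequence has the smaller `d`, with block length equal to the number of special
      -- blocks of the inner one.
      exact (ihd _ fun _ => by omega).merge (ihm (by simp)) (by omega)

end Block

/-! ### Davenport--Schinzel sequences from block sequences -/

theorem Block.exists_isChain_sublist {α : Type} (Z : List (Block α))
    (hZ : ∀ B ∈ Z, B.syms.Nodup) :
    ∃ l : List α, l.Sublist (Block.flat Z) ∧ l.IsChain (· ≠ ·) ∧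
      (Block.flat Z).length ≤ l.length + Z.length := by
  induction Z with
  | nil => exact ⟨[], by simp, by simp, by simp [Block.flat]⟩
  | cons B Z ih =>
    obtain ⟨l, hl, hc, hlen⟩ := ih fun B hB => hZ B (by simp [hB])
    have hB : B.syms.IsChain (· ≠ ·) := List.Pairwise.isChain (hZ B (by simp))
    rw [Block.flat_cons]
    by_cases h : ∀ x ∈ B.syms.getLast?, ∀ y ∈ l.head?, x ≠ y
    · refine ⟨B.syms ++ l, hl.append_left _, List.isChain_append.2 ⟨hB, hc, h⟩, ?_⟩
      simp only [List.length_append, List.length_cons]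
      omega
    · push Not at h
      obtain ⟨x, hx, _, hy, rfl⟩ := h
      cases l with
      | nil => simp at hy
      | cons y l =>
        obtain rfl : y = x := by simpa using hy
        -- One deletion per boundary suffices: the term after the dropped `y` differs from `y`
        -- because the tail is already a chain.
        refine ⟨B.syms ++ l, ((List.sublist_cons_self y l).trans hl).append_left _,
          List.isChain_append.2 ⟨hB, hc.tail, ?_⟩, ?_⟩
        · intro z hz w hw
          obtain rfl := Option.mem_unique hx hz
          cases l with
          | nil => simp at hw
          | cons v l =>
            obtain rfl : v = w := by simpa using hw
            exact (List.isChain_cons_cons.1 hc).1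
        · simp only [List.length_append, List.length_cons] at hlen ⊢
          omega

theorem isDavenportSchinzel_three_iff {S : List ℕ} : IsDavenportSchinzel 3 S ↔
    S.IsChain (· ≠ ·) ∧ ∀ a b, a ≠ b → ¬ [a, b, a, b, a].Sublist S := Iff.rfl

theorem isDavenportSchinzel_three_map {α : Type} {S : List α} {e : α → ℕ}
    (he : Function.Injective e) (h1 : S.IsChain (· ≠ ·))
    (h2 : ∀ a b, a ≠ b → ¬ [a, b, a, b, a].Sublist S) : IsDavenportSchinzel 3 (S.map e) := by
  refine isDavenportSchinzel_three_iff.2 ⟨?_, fun a b hab h => ?_⟩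
  · rw [List.isChain_map]
    exact h1.imp fun _ _ h h' => h (he h')
  · obtain ⟨l, hl, hm⟩ := List.sublist_map_iff.1 h
    obtain ⟨x, l, rfl, rfl, hm⟩ := List.map_eq_cons_iff.1 hm.symm
    obtain ⟨y, l, rfl, rfl, hm⟩ := List.map_eq_cons_iff.1 hm
    obtain ⟨z, l, rfl, hz, hm⟩ := List.map_eq_cons_iff.1 hm
    obtain ⟨u, l, rfl, hu, hm⟩ := List.map_eq_cons_iff.1 hm
    obtain ⟨v, l, rfl, hv, hm⟩ := List.map_eq_cons_iff.1 hm
    obtain rfl := List.map_eq_nil_iff.1 hm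
    obtain rfl := he hz
    obtain rfl := he hu
    obtain rfl := he hv
    exact h2 _ _ (fun h => hab (by rw [h])) hl

/-- Concatenate over disjoint alphabets, even and odd numbers. A pattern `a b a b a` starts and ends
with the same symbol, so it lies in one part. -/
theorem dsLambda_three_add_le (m n : ℕ) : dsLambda 3 m + dsLambda 3 n ≤ dsLambda 3 (m + n) := by
  obtain ⟨S, hS, hSm, hSl⟩ := (isGreatest_dsLambda 3 m (by norm_num)).1
  obtain ⟨T, hT, hTn, hTl⟩ := (isGreatest_dsLambda 3 n (by norm_num)).1
  let e : ℕ → ℕ := fun x => 2 * x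
  let o : ℕ → ℕ := fun x => 2 * x + 1
  have he : Function.Injective e := fun x y h => by simpa [e] using h
  have ho : Function.Injective o := fun x y h => by simpa [o] using h
  have hS' := isDavenportSchinzel_three_iff.1 (isDavenportSchinzel_three_map he hS.1 hS.2)
  have hT' := isDavenportSchinzel_three_iff.1 (isDavenportSchinzel_three_map ho hT.1 hT.2)
  have heS : ∀ x ∈ S.map e, x % 2 = 0 := by simp [e]
  have hoT : ∀ x ∈ T.map o, x % 2 = 1 := by simp [o]
  refine (isGreatest_dsLambda 3 (m + n) (by norm_num)).2 ⟨S.map e ++ T.map o,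
    isDavenportSchinzel_three_iff.2 ⟨List.isChain_append.2 ⟨hS'.1, hT'.1, ?_⟩, ?_⟩, ?_, ?_⟩
  · intro x hx y hy
    have h1 := heS x (List.mem_of_mem_getLast? hx)
    have h2 := hoT y (List.mem_of_mem_head? hy)
    rintro rfl
    omega
  · intro a b hab h
    rcases Nat.mod_two_eq_zero_or_one a with ha | ha
    · refine hS'.2 a b hab (Block.sublist_of_append_sublist_append (l := [a, b, a, b]) h ?_)
      intro h
      have := hoT a h
      omega
    · refine hT'.2 a b hab (Block.sublist_of_cons_sublist_append h ?_)
      intro h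
      have := heS a h
      omega
  · rw [List.toFinset_append, Finset.card_union_of_disjoint, ← hSm, ← hTn]
    · congr 1
      · rw [← Finset.card_image_of_injective S.toFinset he]
        congr 1
        ext
        simp
      · rw [← Finset.card_image_of_injective T.toFinset ho]
        congr 1
        ext
        simp
    · rw [Finset.disjoint_left]
      intro x hx hx'
      have h1 := heS x (List.mem_toFinset.1 hx)
      have h2 := hoT x (List.mem_toFinset.1 hx')
      omega
  · simp [hSl, hTl]

theorem dsLambda_three_mono : Monotone (dsLambda 3) := fun m n h => by
  obtain ⟨k, rfl⟩ := Nat.exists_eq_add_of_le h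
  have := dsLambda_three_add_le m k
  omega

theorem mul_dsLambda_three_le (q n : ℕ) : q * dsLambda 3 n ≤ dsLambda 3 (q * n) := by
  induction q with
  | zero => simp
  | succ q ih =>
    have := dsLambda_three_add_le (q * n) n
    rw [add_mul, add_mul, one_mul, one_mul]
    omega

/-- Deleting at most one term per block leaves a Davenport–Schinzel sequence. The list `l` only
bounds its number of symbols from above; monotonicity makes up for the difference. -/
theorem Block.Realizable.le_dsLambda {d m S : ℕ} (h : Block.Realizable d m S) :
    ∃ N, 2 * N = m * S ∧ 2 * d * N ≤ dsLambda 3 N + 2 * S := by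
  obtain ⟨α, _, Z, l, hZ, -, -, hl, hflat, hsub, hcard⟩ := h
  refine ⟨l.length, hl, ?_⟩
  obtain ⟨e, he⟩ := exists_injective_nat α
  obtain ⟨W, hW, hc, hlen⟩ := Block.exists_isChain_sublist Z hZ.nodup
  have hds : IsDavenportSchinzel 3 (W.map e) :=
    isDavenportSchinzel_three_map he hc fun a b hab h => hZ.avoid a b hab (h.trans hW)
  have h1 : (W.map e).toFinset.card ≤ l.length := by
    rw [← List.length_map (as := l) e]
    refine le_trans (Finset.card_le_card ?_) (List.toFinset_card_le _)
    intro x hx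
    rw [List.mem_toFinset, List.mem_map] at hx ⊢
    obtain ⟨y, hy, rfl⟩ := hx
    exact ⟨y, hsub (hW.subset hy), rfl⟩
  have h2 : W.length ≤ dsLambda 3 (W.map e).toFinset.card :=
    (isGreatest_dsLambda 3 _ (by norm_num)).2 ⟨W.map e, hds, rfl, by simp⟩
  have h3 := dsLambda_three_mono h1
  omega

/-! ### Comparison with the Ackermann hierarchy -/

theorem ackHierarchy_succ_succ (k n : ℕ) : ackHierarchy (k + 2) (n + 1) =
    ackHierarchy (k + 1) (ackHierarchy (k + 2) n) := by
  simp only [ackHierarchy, Function.iterate_succ_apply']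

theorem ackHierarchy_two (n : ℕ) : ackHierarchy 2 n = 2 ^ n := by
  induction n with
  | zero => rfl
  | succ n ih => rw [ackHierarchy_succ_succ, ih, pow_succ']; rfl

theorem two_pow_le_ackHierarchy (k n : ℕ) : 2 ^ n ≤ ackHierarchy (k + 2) n := by
  induction k generalizing n with
  | zero => exact (ackHierarchy_two n).ge
  | succ k ih =>
    cases n with
    | zero => exact le_rfl
    | succ n =>
      rw [ackHierarchy_succ_succ]
      have h : n < ackHierarchy (k + 3) n := by
        rcases Nat.eq_zero_or_pos n with rfl | hn
        · exact Nat.one_pos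
        · exact (ackHierarchy_props (k + 2)).2 n hn
      exact (ih (n + 1)).trans ((ackHierarchy_props (k + 1)).1.monotone h)

theorem mul_self_le_two_pow {y : ℕ} (hy : 4 ≤ y) : y * y ≤ 2 ^ y := by
  induction y, hy using Nat.le_induction with
  | base => norm_num
  | succ y hy ih => rw [pow_succ]; nlinarith

/-- The summand 4, against the shift 3 in the argument, buys one extra iteration of the level below.
That iteration is at least exponential and absorbs the factor in the recursion for `specCount`. -/
theorem Block.specCount_le_ackHierarchy (d m : ℕ) :
    Block.specCount d m + 4 ≤ ackHierarchy (d + 3) (m + 3) := by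
  induction d generalizing m with
  | zero =>
    have h1 := two_pow_le_ackHierarchy 1 (m + 3)
    have h2 : m + 1 ≤ 2 ^ m := Nat.lt_two_pow_self
    rw [pow_add] at h1
    rw [Block.specCount, zero_add]
    change 2 ^ m * 2 ^ 3 ≤ ackHierarchy 3 (m + 3) at h1
    omega
  | succ d ihd =>
    induction m with
    | zero =>
      have h1 := two_pow_le_ackHierarchy (d + 2) 3
      rw [Block.specCount]
      exact h1
    | succ m ihm =>
      rw [Block.specCount, ackHierarchy_succ_succ]
      set f := Block.specCount (d + 1) m with hf
      have hf4 : 4 ≤ f := Block.four_le_specCount (d + 1) m (by simp)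
      have h1 := ihd f
      set y := ackHierarchy (d + 3) (f + 3) with hy
      have hfy : f + 3 < y := (ackHierarchy_props (d + 2)).2 _ (by omega)
      calc f * Block.specCount d f + 4 ≤ y * y := by nlinarith
        _ ≤ 2 ^ y := mul_self_le_two_pow (by omega)
        _ ≤ ackHierarchy (d + 2) y := two_pow_le_ackHierarchy d y
        _ = ackHierarchy (d + 3) (f + 4) := (ackHierarchy_succ_succ (d + 1) (f + 3)).symm
        _ ≤ _ := (ackHierarchy_props (d + 2)).1.monotone ihm

theorem ackermann_succ (k : ℕ) : ackermann (k + 2) = ackHierarchy (k + 1) 4 := by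
  have h := ackHierarchy_succ_succ k 2
  rwa [(ackHierarchy_one_two (k + 1)).2] at h

/-- Ensures that `d * N` stays below `n` in the final estimate, so rounding `n` down to a multiple
of `N` costs only `O(n)`. -/
theorem mul_ackermann_le (k : ℕ) : (k + 3) * ackermann (k + 3) ≤ ackermann (k + 4) := by
  have h1 : k + 2 < ackermann (k + 3) := lt_ackermann_succ (k + 2)
  have h2 : 2 ^ 3 ≤ ackermann (k + 3) := two_pow_le_ackHierarchy (k + 1) 3
  calc (k + 3) * ackermann (k + 3) ≤ ackermann (k + 3) * ackermann (k + 3) :=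
        Nat.mul_le_mul_right _ h1
    _ ≤ 2 ^ ackermann (k + 3) := mul_self_le_two_pow (by omega)
    _ ≤ ackHierarchy (k + 2) (ackermann (k + 3)) := two_pow_le_ackHierarchy k _
    _ = ackHierarchy (k + 3) 4 := (ackHierarchy_succ_succ (k + 1) 3).symm
    _ = ackermann (k + 4) := (ackermann_succ (k + 2)).symm

/-- The sequence constructed for `d + 2` and `m = 1`. -/
theorem exists_dsLambda_three_ge (d : ℕ) :
    ∃ N, 0 < N ∧ (d + 2) * N ≤ ackermann (d + 6) ∧ 2 * d * N ≤ dsLambda 3 N := by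
  obtain ⟨N, hN, h⟩ := (Block.realizable_specCount (d + 1) 1 (by simp)).le_dsLambda
  have h1 := Block.four_le_specCount (d + 1) 1 (by simp)
  have h2 : Block.specCount (d + 1) 1 + 4 ≤ ackermann (d + 5) := by
    rw [ackermann_succ]
    exact Block.specCount_le_ackHierarchy (d + 1) 1
  -- For `m = 1` one has `S = 2 * N`, so the deletions cost at most `4 * N`; starting from `d + 2`
  -- compensates for this.
  have h3 : (d + 5) * ackermann (d + 5) ≤ ackermann (d + 6) := mul_ackermann_le (d + 2)
  exact ⟨N, by omega, le_trans (Nat.mul_le_mul (by omega) (by omega)) h3, by nlinarith⟩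

theorem mainTheorem6 :
    ∃ C : ℝ, ∀ n : ℕ, 1 ≤ n →
      2 * (n : ℝ) * (inverseAckermann n : ℝ) - C * (n : ℝ) ≤ (dsLambda 3 n : ℝ) := by
  -- Writing the inverse Ackermann value as `7 + d` loses `14 * n`, and rounding `n` down to a
  -- multiple of `N` loses at most `2 * d * N ≤ 2 * n`. Values below 7 need only `12 * n`.
  refine ⟨16, fun n hn => ?_⟩
  suffices h : 2 * n * inverseAckermann n ≤ dsLambda 3 n + 16 * n by
    have h' : (2 * n * inverseAckermann n : ℝ) ≤ dsLambda 3 n + 16 * n := by exact_mod_cast h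
    linarith
  rcases Nat.lt_or_ge (inverseAckermann n) 7 with hα | hα
  · nlinarith
  · obtain ⟨d, hd⟩ := Nat.exists_eq_add_of_le hα
    have hlt : ackermann (d + 6) < n := by
      by_contra! hle
      have : inverseAckermann n ≤ d + 6 := Nat.find_min' (exists_le_ackermann n) ⟨by omega, hle⟩
      omega
    obtain ⟨N, hN, hNA, hNL⟩ := exists_dsLambda_three_ge d
    have h1 : n / N * (2 * d * N) ≤ dsLambda 3 n :=
      (Nat.mul_le_mul_left _ hNL).trans ((mul_dsLambda_three_le (n / N) N).trans
        (dsLambda_three_mono (Nat.div_mul_le_self n N)))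
    have h2 : n < n / N * N + N := by
      have := Nat.div_add_mod n N
      have := Nat.mod_lt n hN
      rw [mul_comm]
      omega
    have h3 : d * N ≤ n := by nlinarith
    have h4 : d * n ≤ d * (n / N * N + N) := Nat.mul_le_mul_left d h2.le
    rw [hd]
    nlinarith
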